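/- **Parabolic intermediate value lemma.** Let $d\ge 1$, let $B_r(x_0)\subset\mathbb R^d$ be the open Euclidean ball, $B_r=B_r(0)$, let $Q_r=(-r^2,0)\times B_r$ and $\overline{Q_1}=(-2,-1)\times B_1$, and let $|E|$ denote the Lebesgue measure of $E$. Let $\gamma_1,\gamma_2,\gamma_3>0$ and $1\le p\le\frac{d+2}{d}$. The De Giorgi class $DG^+(\gamma_1,\gamma_2,\gamma_3,p)$ on $Q_2=(-4,0)\times B_2$ is the set of functions $u=u(t,x)$ with $u\in L^\infty((-4,0);L^2(B_2))$ and weak spatial gradient $\nabla_xu\in L^2(Q_2)$ such that, for all $k\in\mathbb R$, all $0<r<R$ and all $x_0\in B_2$ with $B_R(x_0)\subset B_2$, for almost every $s\in(-4,0)$ and almost every $t\in(s,0)$, $$\int_{B_r(x_0)}(u-k)_+^2(t,x)\,dx+\gamma_1\int_s^t\!\!\int_{B_r(x_0)}|\nabla_x(u-k)_+|^2\,dx\,d\tau\le\int_{B_R(x_0)}(u-k)_+^2(s,x)\,dx+\frac{\gamma_2}{(R-r)^2}\int_s^t\!\!\int_{B_R(x_0)}(u-k)_+^2\,dx\,d\tau+\gamma_3\Big(\int_s^t\!\!\int_{B_R(x_0)}(u-k)_+^p\,dx\,d\tau\Big)^{1/p},$$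 where $v_+=\max(v,0)$. For every $k\in\mathbb R$ there is a constant $C>0$, depending only on $d,k,\gamma_1,\gamma_2,\gamma_3$ and $p$, such that for every $u\in DG^+(\gamma_1,\gamma_2,\gamma_3,p)$ on $Q_2$ with $u\le 1$ almost everywhere on $Q_{3/2}$ and every $l$ with $k<l\le 1$, $$(l-k)^2\,\big|\{u\le k\}\cap\overline{Q_1}\big|\,\big|\{u\ge l\}\cap Q_1\big|\le C\,\big|\{k<u<l\}\cap Q_2\big|^{\frac1{4p+2}}.$$ -/

import Mathlib

open MeasureTheory Set
open scoped ENNReal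

namespace ParabolicDG

/-- `ℝ^d` with its Euclidean norm. -/
abbrev Space (d : ℕ) : Type := EuclideanSpace ℝ (Fin d)

/-- The parabolic cylinder `Q_r = (-r², 0) × B_r`. -/
def cylinder (d : ℕ) (r : ℝ) : Set (ℝ × Space d) :=
  Ioo (-r ^ 2) 0 ×ˢ Metric.ball (0 : Space d) r

/-- The earlier cylinder `(-2, -1) × B_1`. -/
def earlierCylinder (d : ℕ) : Set (ℝ × Space d) :=
  Ioo (-2 : ℝ) (-1) ×ˢ Metric.ball (0 : Space d) 1

/-- `G` is the weak spatial gradient `∇_x f` of `f` on the open set `Q` of space-time: for every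
test function `φ ∈ C_c^∞(Q)` and every spatial direction `e`,
`∫_Q f ∂_e φ = - ∫_Q φ ⟨G, e⟩`. -/
def HasWeakSpatialGradient {d : ℕ} (Q : Set (ℝ × Space d)) (f : ℝ × Space d → ℝ)
    (G : ℝ × Space d → Space d) : Prop :=
  LocallyIntegrableOn f Q volume ∧ LocallyIntegrableOn G Q volume ∧
    ∀ φ : ℝ × Space d → ℝ, ContDiff ℝ ((⊤ : ℕ∞) : WithTop ℕ∞) φ → HasCompactSupport φ → tsupport φ ⊆ Q →
      ∀ e : Space d,
        ∫ z in Q, f z * fderiv ℝ φ z (0, e) = - ∫ z in Q, φ z * inner ℝ (G z) e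

/-- `u ∈ L^∞((T₁, T₂); L²(Ω))`, for `u` a function on space-time. -/
def MemLinftyL2 {d : ℕ} (Ω : Set (Space d)) (T₁ T₂ : ℝ) (u : ℝ × Space d → ℝ) : Prop :=
  AEStronglyMeasurable u (volume.restrict (Ioo T₁ T₂ ×ˢ Ω)) ∧
    ∃ M : ℝ≥0∞, M < ∞ ∧
      ∀ᵐ t ∂(volume.restrict (Ioo T₁ T₂)),
        eLpNorm (fun x => u (t, x)) 2 (volume.restrict Ω) ≤ M

/-- The positive part `(u - k)_+`. -/
def truncPos {d : ℕ} (u : ℝ × Space d → ℝ) (k : ℝ) (z : ℝ × Space d) : ℝ :=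
  max (u z - k) 0

/-- The local energy inequality of the De Giorgi sub-class at the level `k` between the times `s`
and `t`, on the balls `B_r(x₀) ⊆ B_R(x₀)`; here `G` stands for `∇_x (u - k)_+`.
All integrands are nonnegative, and all integrals are taken in `[0, ∞]`. -/
def EnergyInequality {d : ℕ} (γ₁ γ₂ γ₃ p : ℝ) (u : ℝ × Space d → ℝ) (k : ℝ)
    (G : ℝ × Space d → Space d) (x₀ : Space d) (r R s t : ℝ) : Prop :=
  (∫⁻ x in Metric.ball x₀ r, ENNReal.ofReal (truncPos u k (t, x) ^ 2))
      + ENNReal.ofReal γ₁ * (∫⁻ τ in Ioo s t, ∫⁻ x in Metric.ball x₀ r, ‖G (τ, x)‖ₑ ^ 2)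
    ≤ (∫⁻ x in Metric.ball x₀ R, ENNReal.ofReal (truncPos u k (s, x) ^ 2))
      + ENNReal.ofReal (γ₂ / (R - r) ^ 2) *
          (∫⁻ τ in Ioo s t, ∫⁻ x in Metric.ball x₀ R, ENNReal.ofReal (truncPos u k (τ, x) ^ 2))
      + ENNReal.ofReal γ₃ *
          (∫⁻ τ in Ioo s t, ∫⁻ x in Metric.ball x₀ R,
            ENNReal.ofReal (truncPos u k (τ, x) ^ p)) ^ (1 / p)

/-- The parabolic De Giorgi sub-class `DG⁺(γ₁, γ₂, γ₃, p)` on `(T₁, T₂) × Ω`, for a bounded open set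
`Ω`, positive `γ₁, γ₂, γ₃` and `1 ≤ p ≤ (d + 2) / d`.  An element of `L^∞((T₁, T₂); L²(Ω))` has
values at almost every time only, so the energy inequality is required for almost every `s` and
almost every `t > s` in `(T₁, T₂)`. -/
structure DGPlus {d : ℕ} (Ω : Set (Space d)) (T₁ T₂ γ₁ γ₂ γ₃ p : ℝ)
    (u : ℝ × Space d → ℝ) : Prop where
  memLinftyL2 : MemLinftyL2 Ω T₁ T₂ u
  gradient_memL2 : ∃ G : ℝ × Space d → Space d,
    HasWeakSpatialGradient (Ioo T₁ T₂ ×ˢ Ω) u G ∧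
      MemLp G 2 (volume.restrict (Ioo T₁ T₂ ×ˢ Ω))
  energy : ∀ k : ℝ, ∃ G : ℝ × Space d → Space d,
    HasWeakSpatialGradient (Ioo T₁ T₂ ×ˢ Ω) (truncPos u k) G ∧
      ∀ r R : ℝ, 0 < r → r < R → ∀ x₀ ∈ Ω, Metric.ball x₀ R ⊆ Ω →
        ∀ᵐ s ∂(volume.restrict (Ioo T₁ T₂)), ∀ᵐ t ∂(volume.restrict (Ioo T₁ T₂)),
          s < t → EnergyInequality γ₁ γ₂ γ₃ p u k G x₀ r R s t

end ParabolicDG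

/-!
Let `w = (u - k)_+` and let `A(t)`, `B(t)`, `D(t)` be the volumes of `{w = 0}`, `{w ≥ l - k}` and of
the set in between, on the slice of `(-2, 0) × B_1` at time `t`. De Giorgi's isoperimetric
inequality on the slices and the Cauchy–Schwarz inequality bound `∫ A B` by `(∫ D) ^ (1 / 2)` times
a constant involving the gradient energy, so `F = A B + D` is small at most times. At a time where
`F` is small and `B` is not too large, `B ≲ F`, because `A` is then bounded below; the energy
inequality keeps `B` from becoming large during a short window of time, and the next time with
small `F` in the window starts a new one. Hence either some early time with small `F` has `B` not
too large, and then `B ≲ F` at all later times, or `B` is bounded below at almost every early time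
with small `F`, and then `A ≲ F` there. In both cases the product of `∫ A` over early and `∫ B` over
late times is controlled by `∫ F`.
-/

namespace ParabolicDG

section TimePropagation

theorem exists_mem_Ioo_notMem_of_ae {a b c e : ℝ} {N : Set ℝ} {Q : ℝ → Prop} (hac : a ≤ c)
    (heb : e ≤ b) (hN : volume (Ioo a b ∩ N) < ENNReal.ofReal (e - c))
    (hQ : ∀ᵐ s ∂volume.restrict (Ioo a b), Q s) : ∃ s ∈ Ioo c e, s ∉ N ∧ Q s := by
  have hsub : Ioo c e ⊆ Ioo a b := Ioo_subset_Ioo hac heb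
  have hpos : volume (Ioo c e \ (Ioo a b ∩ N)) ≠ 0 := by
    refine ((tsub_pos_of_lt ?_).trans_le le_measure_sdiff).ne'
    rwa [Real.volume_Ioo]
  obtain ⟨s, hs, hQs⟩ := Measure.exists_mem_of_measure_ne_zero_of_ae hpos
    (ae_restrict_of_ae_restrict_of_subset (sdiff_subset.trans hsub) hQ)
  exact ⟨s, hs.1, fun hsN => hs.2 ⟨hsub hs.1, hsN⟩, hQs⟩

/- The window is extended by `δ / 2` at a time: every interval of this length contains a time
outside `N` from which `P` can be propagated further. -/
theorem ae_of_local_propagation {a b δ s₀ : ℝ} {P : ℝ → Prop} {N : Set ℝ} (hδ : 0 < δ)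
    (hs₀ : a ≤ s₀) (hN : volume (Ioo a b ∩ N) < ENNReal.ofReal (δ / 2))
    (hstep : ∀ᵐ s ∂volume.restrict (Ioo a b), s ∉ N → P s →
      ∀ᵐ t ∂volume.restrict (Ioo a b), t ∈ Ioo s (s + δ) → P t)
    (hstart : ∀ᵐ t ∂volume.restrict (Ioo a b), t ∈ Ioo s₀ (s₀ + δ) → P t) :
    ∀ᵐ t ∂volume.restrict (Ioo a b), s₀ < t → P t := by
  have hwindow (n : ℕ) : ∀ᵐ t ∂volume.restrict (Ioo a b),
      t ∈ Ioo s₀ (s₀ + (n + 2) * (δ / 2)) → P t := by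
    induction n with
    | zero =>
      convert hstart using 5
      push_cast
      ring
    | succ n ih =>
      rcases le_or_gt b (s₀ + (n + 2) * (δ / 2)) with hend | hend
      · filter_upwards [ih, ae_restrict_mem measurableSet_Ioo] with t ht htab hts
        exact ht ⟨hts.1, htab.2.trans_le hend⟩
      · have hnδ : 0 ≤ (n + 1) * (δ / 2) := by positivity
        obtain ⟨s, hs, hsN, hsstep, hsP⟩ := exists_mem_Ioo_notMem_of_ae
          (c := s₀ + (n + 1) * (δ / 2)) (by linarith) hend.le
          (by convert hN using 2; ring) (hstep.and ih)
        filter_upwards [hsstep hsN (hsP ⟨by linarith [hs.1], hs.2⟩), ih] with t hafter hbefore ht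
        rcases lt_or_ge s t with hst | hts
        · refine hafter ⟨hst, ht.2.trans ?_⟩
          push_cast
          linarith [hs.1]
        · exact hbefore ⟨ht.1, hts.trans_lt hs.2⟩
  obtain ⟨n, hn⟩ := exists_nat_gt ((b - s₀) / (δ / 2))
  rw [div_lt_iff₀ (by positivity)] at hn
  filter_upwards [hwindow n, ae_restrict_mem measurableSet_Ioo] with t ht htab hst
  exact ht ⟨hst, by linarith [htab.2]⟩

/-- The time slices of the level sets of one function `u` on `(-2, 0) × B_1`: `V` is the volume
of the ball, `A t`, `B t` and `D t` are the volumes of the slices at time `t` of `{u ≤ k}`,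
`{l ≤ u}` and `{k < u < l}`.  The level gap `l - k` enters as `θ`, relative to the distance from
`k` to the upper bound of `u`, and `x` is the `(4p + 2)`-th root of the volume of `{k < u < l}`. -/
structure LevelProfile (p V K θ x : ℝ) (A B D : ℝ → ℝ) : Prop where
  measurable_low : Measurable A
  measurable_high : Measurable B
  measurable_mid : Measurable D
  low_nonneg : ∀ t, 0 ≤ A t
  high_nonneg : ∀ t, 0 ≤ B t
  mid_nonneg : ∀ t, 0 ≤ D t
  add_eq : ∀ t, A t + B t + D t = V
  isoperimetric : ∫ t in Ioo (-2 : ℝ) 0, A t * B t ≤ K * x ^ (2 * p + 1) / θ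
  integral_mid_le : ∫ t in Ioo (-2 : ℝ) 0, D t ≤ x ^ (4 * p + 2)
  propagation : ∀ᵐ s ∂volume.restrict (Ioo (-2 : ℝ) 0),
    ∀ᵐ t ∂volume.restrict (Ioo (-2 : ℝ) 0), s < t →
      θ ^ 2 * (B t - V / 8) ≤ K * (B s + D s + (t - s) ^ (1 / p))

namespace LevelProfile

variable {p V K θ x ε δ : ℝ} {A B D : ℝ → ℝ}

theorem low_le (h : LevelProfile p V K θ x A B D) (t : ℝ) : A t ≤ V := by
  linarith [h.add_eq t, h.high_nonneg t, h.mid_nonneg t]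

theorem high_le (h : LevelProfile p V K θ x A B D) (t : ℝ) : B t ≤ V := by
  linarith [h.add_eq t, h.low_nonneg t, h.mid_nonneg t]

theorem mid_le (h : LevelProfile p V K θ x A B D) (t : ℝ) : D t ≤ V := by
  linarith [h.add_eq t, h.low_nonneg t, h.high_nonneg t]

theorem low_mul_high_nonneg (h : LevelProfile p V K θ x A B D) (t : ℝ) : 0 ≤ A t * B t :=
  mul_nonneg (h.low_nonneg t) (h.high_nonneg t)

theorem defect_nonneg (h : LevelProfile p V K θ x A B D) (t : ℝ) : 0 ≤ A t * B t + D t :=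
  add_nonneg (h.low_mul_high_nonneg t) (h.mid_nonneg t)

theorem high_add_mid_le (h : LevelProfile p V K θ x A B D) (hV : 0 < V) {t : ℝ}
    (hB : B t ≤ V / 4) : B t + D t ≤ (2 / V + 2) * (A t * B t + D t) := by
  have hAB : 0 ≤ 2 / V * (A t * B t) := by have := h.low_mul_high_nonneg t; positivity
  have hD : 0 ≤ 2 / V * D t := by have := h.mid_nonneg t; positivity
  rcases le_total (D t) (V / 4) with hmid | hmid
  · have hA : V / 2 ≤ A t := by linarith [h.add_eq t]
    have : B t ≤ 2 / V * (A t * B t) := calc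
      B t = 2 / V * (V / 2 * B t) := by field_simp
      _ ≤ 2 / V * (A t * B t) := by gcongr; exact h.high_nonneg t
    linarith [h.mid_nonneg t, h.low_mul_high_nonneg t]
  · linarith [h.low_mul_high_nonneg t]

theorem low_le_of_high (h : LevelProfile p V K θ x A B D) (hV : 0 < V) (hε : 0 < ε) {t : ℝ}
    (ht : B t ≤ V / 4 → ε < A t * B t + D t) :
    A t ≤ (4 / V + V / ε) * (A t * B t + D t) := by
  have hF := h.defect_nonneg t
  rcases le_or_gt (B t) (V / 4) with hB | hB
  · calc A t ≤ V / ε * ε := by rw [div_mul_cancel₀ _ hε.ne']; exact h.low_le t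
      _ ≤ V / ε * (A t * B t + D t) := by gcongr; exact (ht hB).le
      _ ≤ (4 / V + V / ε) * (A t * B t + D t) := by gcongr; linarith [show 0 < 4 / V by positivity]
  · calc A t = 4 / V * (A t * (V / 4)) := by field_simp
      _ ≤ 4 / V * (A t * B t + D t) := by
          gcongr
          have := mul_le_mul_of_nonneg_left hB.le (h.low_nonneg t)
          linarith [h.mid_nonneg t]
      _ ≤ (4 / V + V / ε) * (A t * B t + D t) := by gcongr; linarith [show 0 < V / ε by positivity]

theorem integrableOn_high (h : LevelProfile p V K θ x A B D) (a b : ℝ) :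
    IntegrableOn B (Ioo a b) :=
  .of_mem_Icc 0 V h.measurable_high.aemeasurable
    (.of_forall fun t => ⟨h.high_nonneg t, h.high_le t⟩)

theorem integrableOn_low (h : LevelProfile p V K θ x A B D) (a b : ℝ) :
    IntegrableOn A (Ioo a b) :=
  .of_mem_Icc 0 V h.measurable_low.aemeasurable (.of_forall fun t => ⟨h.low_nonneg t, h.low_le t⟩)

theorem integrableOn_mid (h : LevelProfile p V K θ x A B D) (a b : ℝ) :
    IntegrableOn D (Ioo a b) :=
  .of_mem_Icc 0 V h.measurable_mid.aemeasurable (.of_forall fun t => ⟨h.mid_nonneg t, h.mid_le t⟩)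

theorem integrableOn_mul (h : LevelProfile p V K θ x A B D) (a b : ℝ) :
    IntegrableOn (fun t => A t * B t) (Ioo a b) :=
  .of_mem_Icc 0 (V * V) (h.measurable_low.mul h.measurable_high).aemeasurable
    (.of_forall fun t => ⟨h.low_mul_high_nonneg t, mul_le_mul (h.low_le t) (h.high_le t)
      (h.high_nonneg t) ((h.low_nonneg t).trans (h.low_le t))⟩)

theorem integrableOn_defect (h : LevelProfile p V K θ x A B D) (a b : ℝ) :
    IntegrableOn (fun t => A t * B t + D t) (Ioo a b) :=
  (h.integrableOn_mul a b).add (h.integrableOn_mid a b)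

theorem integral_high_nonneg (h : LevelProfile p V K θ x A B D) (a b : ℝ) :
    0 ≤ ∫ t in Ioo a b, B t :=
  setIntegral_nonneg measurableSet_Ioo fun t _ => h.high_nonneg t

theorem integral_low_nonneg (h : LevelProfile p V K θ x A B D) (a b : ℝ) :
    0 ≤ ∫ t in Ioo a b, A t :=
  setIntegral_nonneg measurableSet_Ioo fun t _ => h.low_nonneg t

theorem integral_low_le (h : LevelProfile p V K θ x A B D) :
    ∫ t in Ioo (-2 : ℝ) (-1), A t ≤ V := calc
  _ ≤ ∫ _ in Ioo (-2 : ℝ) (-1), V :=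
    setIntegral_mono (h.integrableOn_low _ _) (by simp) h.low_le
  _ = V := by norm_num

theorem integral_high_le (h : LevelProfile p V K θ x A B D) :
    ∫ t in Ioo (-1 : ℝ) 0, B t ≤ V := calc
  _ ≤ ∫ _ in Ioo (-1 : ℝ) 0, V :=
    setIntegral_mono (h.integrableOn_high _ _) (by simp) h.high_le
  _ = V := by norm_num

theorem volume_defect_lt (h : LevelProfile p V K θ x A B D) (hε : 0 < ε)
    (hF : ∫ t in Ioo (-2 : ℝ) 0, (A t * B t + D t) < ε * (δ / 2)) :
    volume (Ioo (-2 : ℝ) 0 ∩ {t | ε < A t * B t + D t}) < ENNReal.ofReal (δ / 2) := by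
  have hδ : 0 < δ / 2 := pos_of_mul_pos_right
    ((setIntegral_nonneg measurableSet_Ioo fun t _ => h.defect_nonneg t).trans_lt hF) hε.le
  have hmarkov := mul_meas_ge_le_integral_of_nonneg (.of_forall h.defect_nonneg)
    (h.integrableOn_defect (-2) 0) ε
  have hsub : volume.real (Ioo (-2 : ℝ) 0 ∩ {t | ε < A t * B t + D t}) ≤
      (volume.restrict (Ioo (-2 : ℝ) 0)).real {t | ε ≤ A t * B t + D t} := by
    rw [measureReal_restrict_apply' measurableSet_Ioo, inter_comm]
    exact measureReal_mono (inter_subset_inter_left _ (ofPred_subset_ofPred.2 fun _ ht => ht.le))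
      (measure_inter_lt_top_of_right_ne_top (by simp)).ne
  rw [← ENNReal.ofReal_toReal (measure_inter_lt_top_of_left_ne_top (by simp)).ne,
    ENNReal.ofReal_lt_ofReal_iff hδ]
  exact lt_of_mul_lt_mul_left ((mul_le_mul_of_nonneg_left hsub hε.le).trans_lt
    (hmarkov.trans_lt hF)) hε.le

theorem high_le_quarter_of_propagation (h : LevelProfile p V K θ x A B D) (hp : 0 < p)
    (hV : 0 < V) (hK : 0 < K) (hθ : 0 < θ) (hε : K * ((2 / V + 2) * ε) ≤ θ ^ 2 * (V / 16))
    (hδ : K * δ ^ (1 / p) ≤ θ ^ 2 * (V / 16)) {s t : ℝ} (hs : A s * B s + D s ≤ ε)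
    (hBs : B s ≤ V / 4) (ht : t ∈ Ioo s (s + δ))
    (hst : θ ^ 2 * (B t - V / 8) ≤ K * (B s + D s + (t - s) ^ (1 / p))) : B t ≤ V / 4 := by
  have hslice : B s + D s ≤ (2 / V + 2) * ε :=
    (h.high_add_mid_le hV hBs).trans (by gcongr)
  have htime : (t - s) ^ (1 / p) ≤ δ ^ (1 / p) :=
    Real.rpow_le_rpow (sub_nonneg.2 ht.1.le) (by linarith [ht.2]) (by positivity)
  have : θ ^ 2 * (B t - V / 8) ≤ θ ^ 2 * (V / 8) := calc
    θ ^ 2 * (B t - V / 8) ≤ K * (B s + D s + (t - s) ^ (1 / p)) := hst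
    _ ≤ K * ((2 / V + 2) * ε + δ ^ (1 / p)) := by gcongr
    _ ≤ θ ^ 2 * (V / 8) := by linarith
  linarith [le_of_mul_le_mul_left this (by positivity)]

/- Either some generic early time has a small upper slice, and the smallness propagates to all
later times, or the upper slices are large at almost every generic early time. -/
theorem dichotomy (h : LevelProfile p V K θ x A B D) (hp : 0 < p) (hV : 0 < V) (hK : 0 < K)
    (hθ : 0 < θ) (hδ₀ : 0 < δ) (hε : K * ((2 / V + 2) * ε) ≤ θ ^ 2 * (V / 16))
    (hδ : K * δ ^ (1 / p) ≤ θ ^ 2 * (V / 16))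
    (hN : volume (Ioo (-2 : ℝ) 0 ∩ {t | ε < A t * B t + D t}) < ENNReal.ofReal (δ / 2)) :
    (∀ᵐ t ∂volume.restrict (Ioo (-1 : ℝ) 0), B t ≤ V / 4) ∨
      ∀ᵐ t ∂volume.restrict (Ioo (-2 : ℝ) (-1)), B t ≤ V / 4 → ε < A t * B t + D t := by
  have hstep : ∀ᵐ s ∂volume.restrict (Ioo (-2 : ℝ) 0), s ∉ {t | ε < A t * B t + D t} →
      B s ≤ V / 4 → ∀ᵐ t ∂volume.restrict (Ioo (-2 : ℝ) 0), t ∈ Ioo s (s + δ) → B t ≤ V / 4 := by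
    filter_upwards [h.propagation] with s hs hsN hBs
    filter_upwards [hs] with t hst ht
    exact h.high_le_quarter_of_propagation hp hV hK hθ hε hδ (not_lt.1 hsN) hBs ht (hst ht.1)
  by_cases hgood : ∃ s ∈ Ioo (-2 : ℝ) (-1), ∀ᵐ t ∂volume.restrict (Ioo (-2 : ℝ) 0),
      t ∈ Ioo s (s + δ) → B t ≤ V / 4
  · obtain ⟨s, hs, hstart⟩ := hgood
    left
    filter_upwards [ae_restrict_of_ae_restrict_of_subset (Ioo_subset_Ioo_left (by norm_num))
      (ae_of_local_propagation hδ₀ hs.1.le hN hstep hstart), ae_restrict_mem measurableSet_Ioo]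
      with t ht ht'
    exact ht (hs.2.trans ht'.1)
  · right
    filter_upwards [ae_restrict_of_ae_restrict_of_subset (Ioo_subset_Ioo_right (by norm_num))
      hstep, ae_restrict_mem measurableSet_Ioo] with s hs hs' hBs
    by_contra hF
    exact hgood ⟨s, hs', hs hF hBs⟩

theorem setIntegral_defect_le (h : LevelProfile p V K θ x A B D) {a b : ℝ} (ha : -2 ≤ a)
    (hb : b ≤ 0) :
    ∫ t in Ioo a b, (A t * B t + D t) ≤ ∫ t in Ioo (-2 : ℝ) 0, (A t * B t + D t) :=
  setIntegral_mono_set (h.integrableOn_defect _ _) (.of_forall h.defect_nonneg)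
    (Ioo_subset_Ioo ha hb).eventuallyLE

theorem integral_mul_integral_le_of_high_le_quarter (h : LevelProfile p V K θ x A B D)
    (hV : 0 < V) (hB : ∀ᵐ t ∂volume.restrict (Ioo (-1 : ℝ) 0), B t ≤ V / 4) :
    (∫ t in Ioo (-2 : ℝ) (-1), A t) * ∫ t in Ioo (-1 : ℝ) 0, B t ≤
      V * ((2 / V + 2) * ∫ t in Ioo (-2 : ℝ) 0, (A t * B t + D t)) := by
  have hhigh : ∫ t in Ioo (-1 : ℝ) 0, B t ≤
      (2 / V + 2) * ∫ t in Ioo (-2 : ℝ) 0, (A t * B t + D t) := calc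
    _ ≤ ∫ t in Ioo (-1 : ℝ) 0, (2 / V + 2) * (A t * B t + D t) := by
      refine integral_mono_ae (h.integrableOn_high _ _)
        ((h.integrableOn_defect _ _).const_mul _) ?_
      filter_upwards [hB] with t ht
      linarith [h.high_add_mid_le hV ht, h.mid_nonneg t]
    _ ≤ _ := by
      rw [integral_const_mul]
      exact mul_le_mul_of_nonneg_left (h.setIntegral_defect_le (by norm_num) le_rfl)
        (by positivity)
  exact mul_le_mul h.integral_low_le hhigh (h.integral_high_nonneg _ _) hV.le

theorem integral_mul_integral_le_of_defect_lt (h : LevelProfile p V K θ x A B D) (hV : 0 < V)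
    (hε : 0 < ε)
    (hB : ∀ᵐ t ∂volume.restrict (Ioo (-2 : ℝ) (-1)), B t ≤ V / 4 → ε < A t * B t + D t) :
    (∫ t in Ioo (-2 : ℝ) (-1), A t) * ∫ t in Ioo (-1 : ℝ) 0, B t ≤
      ((4 / V + V / ε) * ∫ t in Ioo (-2 : ℝ) 0, (A t * B t + D t)) * V := by
  have hlow : ∫ t in Ioo (-2 : ℝ) (-1), A t ≤
      (4 / V + V / ε) * ∫ t in Ioo (-2 : ℝ) 0, (A t * B t + D t) := calc
    _ ≤ ∫ t in Ioo (-2 : ℝ) (-1), (4 / V + V / ε) * (A t * B t + D t) := by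
      refine integral_mono_ae (h.integrableOn_low _ _)
        ((h.integrableOn_defect _ _).const_mul _) ?_
      filter_upwards [hB] with t ht
      exact h.low_le_of_high hV hε ht
    _ ≤ _ := by
      rw [integral_const_mul]
      exact mul_le_mul_of_nonneg_left (h.setIntegral_defect_le le_rfl (by norm_num))
        (by positivity)
  exact mul_le_mul hlow h.integral_high_le (h.integral_high_nonneg _ _)
    ((h.integral_low_nonneg _ _).trans hlow)

theorem integral_mul_integral_le_sq (h : LevelProfile p V K θ x A B D) :
    (∫ t in Ioo (-2 : ℝ) (-1), A t) * ∫ t in Ioo (-1 : ℝ) 0, B t ≤ V ^ 2 := by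
  have hV : 0 ≤ V := (h.low_nonneg 0).trans (h.low_le 0)
  rw [sq]
  exact mul_le_mul h.integral_low_le h.integral_high_le (h.integral_high_nonneg _ _) hV

theorem integral_defect_le (h : LevelProfile p V K θ x A B D) (hp : 0 ≤ p) (hK : 1 ≤ K)
    (hθ : 0 < θ) (hθ₁ : θ ≤ 1) (hx : 0 ≤ x) (hx₁ : x ≤ 1) :
    ∫ t in Ioo (-2 : ℝ) 0, (A t * B t + D t) ≤ 2 * K * (x ^ (2 * p + 1) / θ) := by
  have hmid : x ^ (4 * p + 2) ≤ K * x ^ (2 * p + 1) / θ := calc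
    x ^ (4 * p + 2) ≤ x ^ (2 * p + 1) :=
      Real.rpow_le_rpow_of_exponent_ge_of_imp hx hx₁ (by linarith) (by intros; linarith)
    _ ≤ K * x ^ (2 * p + 1) := le_mul_of_one_le_left (by positivity) hK
    _ ≤ K * x ^ (2 * p + 1) / θ := le_div_self (by positivity) hθ hθ₁
  rw [integral_add (h.integrableOn_mul _ _) (h.integrableOn_mid _ _)]
  linarith [h.isoperimetric, h.integral_mid_le, mul_div_assoc K (x ^ (2 * p + 1)) θ]

end LevelProfile

theorem mul_rpow_one_div {p b θ : ℝ} (hb : 0 ≤ b) (hθ : 0 ≤ θ) (hp : p ≠ 0) :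
    (b * θ ^ (2 * p)) ^ (1 / p) = b ^ (1 / p) * θ ^ 2 := by
  rw [Real.mul_rpow hb (by positivity), ← Real.rpow_mul hθ, mul_assoc, mul_one_div_cancel hp,
    mul_one, Real.rpow_two]

theorem rpow_div_le_mul_rpow {p θ x : ℝ} (hp : 1 ≤ p) (hθ : 0 < θ) (hθ₁ : θ ≤ 1) (hx : 0 ≤ x)
    (hxθ : x ≤ θ ^ 2) : x ^ (2 * p + 1) / θ ≤ x * θ ^ (2 * p) := by
  rw [div_le_iff₀ hθ]
  calc x ^ (2 * p + 1) = x * x ^ (2 * p) := by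
        rw [Real.rpow_add_one' hx (by positivity), mul_comm]
    _ ≤ x * θ ^ (2 * (2 * p)) := by
        rw [Real.rpow_mul hθ.le, Real.rpow_two]
        gcongr
    _ ≤ x * θ ^ (2 * p + 1) := by
        gcongr x * ?_
        exact Real.rpow_le_rpow_of_exponent_ge hθ hθ₁ (by linarith)
    _ = x * θ ^ (2 * p) * θ := by rw [Real.rpow_add_one hθ.ne', mul_assoc]

namespace LevelProfile

variable {p V K θ x : ℝ} {A B D : ℝ → ℝ}

theorem integral_defect_le_mul_rpow (h : LevelProfile p V K θ x A B D) (hp : 1 ≤ p)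
    (hK : 1 ≤ K) (hθ : 0 < θ) (hθ₁ : θ ≤ 1) (hx : 0 ≤ x) (hxθ : x ≤ θ ^ 2) :
    ∫ t in Ioo (-2 : ℝ) 0, (A t * B t + D t) ≤ 2 * K * (x * θ ^ (2 * p)) :=
  (h.integral_defect_le (by linarith) hK hθ hθ₁ hx (hxθ.trans (pow_le_one₀ hθ.le hθ₁))).trans
    (mul_le_mul_of_nonneg_left (rpow_div_le_mul_rpow hp hθ hθ₁ hx hxθ) (by linarith))

theorem mul_integral_mul_integral_le_of_small {c b : ℝ} (h : LevelProfile p V K θ x A B D)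
    (hp : 1 ≤ p) (hV : 0 < V) (hK : 1 ≤ K) (hθ : 0 < θ) (hθ₁ : θ ≤ 1) (hx : 0 ≤ x)
    (hc : 0 < c) (hb : 0 < b) (hcK : K * ((2 / V + 2) * c) ≤ V / 16)
    (hbK : K * b ^ (1 / p) ≤ V / 16) (hxθ : x ≤ θ ^ 2) (hxcb : 8 * K * x ≤ c * b * θ ^ 2) :
    θ ^ 2 * ((∫ t in Ioo (-2 : ℝ) (-1), A t) * ∫ t in Ioo (-1 : ℝ) 0, B t) ≤
      V * (2 / V + 2 + (4 / V + V / c)) * (2 * K * x) := by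
  have hθp : 0 < θ ^ (2 * p) := Real.rpow_pos_of_pos hθ _
  have hθsq : θ ^ 2 ≤ 1 := pow_le_one₀ hθ.le hθ₁
  set J := ∫ t in Ioo (-2 : ℝ) 0, (A t * B t + D t)
  have hJ₀ : 0 ≤ J := setIntegral_nonneg measurableSet_Ioo fun t _ => h.defect_nonneg t
  have hJθ : J ≤ 2 * K * (x * θ ^ (2 * p)) :=
    h.integral_defect_le_mul_rpow hp hK hθ hθ₁ hx hxθ
  have hJx : J ≤ 2 * K * x := hJθ.trans <| by
    gcongr
    exact mul_le_of_le_one_right hx (Real.rpow_le_one hθ.le hθ₁ (by linarith))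
  have hJsmall : J < c * θ ^ 2 * (b * θ ^ (2 * p) / 2) := by
    have h₁ := mul_le_mul_of_nonneg_right hxcb hθp.le
    have h₂ : 0 < c * θ ^ 2 * (b * θ ^ (2 * p)) := by positivity
    linarith
  have hε : K * ((2 / V + 2) * (c * θ ^ 2)) ≤ θ ^ 2 * (V / 16) := by
    linarith [mul_le_mul_of_nonneg_left hcK (sq_nonneg θ)]
  have hδ : K * (b * θ ^ (2 * p)) ^ (1 / p) ≤ θ ^ 2 * (V / 16) := by
    rw [mul_rpow_one_div hb.le hθ.le (by linarith)]
    linarith [mul_le_mul_of_nonneg_left hbK (sq_nonneg θ)]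
  have hV₁ : 0 ≤ V * (2 / V + 2) * (2 * K * x) := by positivity
  have hV₂ : 0 ≤ V * (4 / V + V / c) * (2 * K * x) := by positivity
  rcases h.dichotomy (by linarith) hV (by linarith) hθ (by positivity) hε hδ
    (h.volume_defect_lt (by positivity) hJsmall) with hhigh | hlow
  · calc _ ≤ 1 * (V * ((2 / V + 2) * (2 * K * x))) :=
          mul_le_mul hθsq ((h.integral_mul_integral_le_of_high_le_quarter hV hhigh).trans
            (by gcongr)) (mul_nonneg (h.integral_low_nonneg _ _) (h.integral_high_nonneg _ _))
            zero_le_one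
      _ ≤ _ := by linarith
  · calc _ ≤ θ ^ 2 * (((4 / V + V / (c * θ ^ 2)) * J) * V) := by
          exact mul_le_mul_of_nonneg_left
            (h.integral_mul_integral_le_of_defect_lt hV (by positivity) hlow) (sq_nonneg θ)
      _ = V * (4 / V * θ ^ 2 + V / c) * J := by field_simp
      _ ≤ V * (4 / V * 1 + V / c) * (2 * K * x) := by gcongr
      _ ≤ _ := by linarith

theorem exists_mul_integral_mul_integral_le (hp : 1 ≤ p) (hV : 0 < V) (hK : 1 ≤ K) :
    ∃ C : ℝ, 0 < C ∧ ∀ (θ x : ℝ) (A B D : ℝ → ℝ), 0 < θ → θ ≤ 1 → 0 ≤ x →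
      LevelProfile p V K θ x A B D →
        θ ^ 2 * ((∫ t in Ioo (-2 : ℝ) (-1), A t) * ∫ t in Ioo (-1 : ℝ) 0, B t) ≤ C * x := by
  obtain ⟨c, hc, hcK⟩ : ∃ c, 0 < c ∧ K * ((2 / V + 2) * c) ≤ V / 16 :=
    ⟨V / 16 / (K * (2 / V + 2)), by positivity, le_of_eq (by field_simp)⟩
  obtain ⟨b, hb, hbK⟩ : ∃ b, 0 < b ∧ K * b ^ (1 / p) ≤ V / 16 := by
    refine ⟨(V / 16 / K) ^ p, by positivity, le_of_eq ?_⟩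
    rw [one_div, Real.rpow_rpow_inv (by positivity) (by linarith)]
    field_simp
  have hc₀ : 0 < min 1 (c * b / (8 * K)) := by positivity
  refine ⟨V * (2 / V + 2 + (4 / V + V / c)) * (2 * K) + V ^ 2 / min 1 (c * b / (8 * K)),
    by positivity, fun θ x A B D hθ hθ₁ hx h => ?_⟩
  rw [add_mul]
  rcases le_or_gt x (min 1 (c * b / (8 * K)) * θ ^ 2) with hsmall | hlarge
  · have hxθ : x ≤ θ ^ 2 :=
      hsmall.trans (mul_le_of_le_one_left (sq_nonneg θ) (min_le_left _ _))
    have hxcb : x ≤ c * b / (8 * K) * θ ^ 2 :=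
      hsmall.trans (mul_le_mul_of_nonneg_right (min_le_right _ _) (sq_nonneg θ))
    have := h.mul_integral_mul_integral_le_of_small hp hV hK hθ hθ₁ hx hc hb hcK hbK hxθ
      (by rwa [div_mul_eq_mul_div, le_div_iff₀ (by positivity), mul_comm] at hxcb)
    have : 0 ≤ V ^ 2 / min 1 (c * b / (8 * K)) * x := by positivity
    linarith
  · have : θ ^ 2 * V ^ 2 ≤ V ^ 2 / min 1 (c * b / (8 * K)) * x := by
      rw [div_mul_eq_mul_div, le_div_iff₀ hc₀]
      linarith [mul_le_mul_of_nonneg_left hlarge.le (sq_nonneg V)]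
    refine (mul_le_mul_of_nonneg_left h.integral_mul_integral_le_sq (sq_nonneg θ)).trans ?_
    have : 0 ≤ V * (2 / V + 2 + (4 / V + V / c)) * (2 * K) * x := by positivity
    linarith

end LevelProfile
end TimePropagation

section Oscillation

open Module Measure

variable {E F : Type*} [NormedAddCommGroup E] [NormedSpace ℝ E] [NormedAddCommGroup F]
  [NormedSpace ℝ F] {B : Set E} {f : E → F}

theorem enorm_sub_le_lintegral_segment (hf : ContDiff ℝ 1 f) {x y : E} (hx : x ∈ B)
    (hy : y ∈ B) :
    ‖f y - f x‖ₑ ≤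
      Metric.ediam B * ∫⁻ s in Icc (0 : ℝ) 1, ‖fderiv ℝ f ((1 - s) • x + s • y)‖ₑ := by
  have hderiv (s : ℝ) : HasDerivAt (fun s : ℝ => f ((1 - s) • x + s • y))
      (fderiv ℝ f ((1 - s) • x + s • y) (y - x)) s := by
    refine ((hf.differentiable one_ne_zero) _).hasFDerivAt.comp_hasDerivAt s ?_
    simpa [sub_eq_neg_add] using (((hasDerivAt_id' s).const_sub 1).smul_const x).fun_add
      ((hasDerivAt_id' s).smul_const y)
  calc ‖f y - f x‖ₑ
      ≤ ∫⁻ s in Icc (0 : ℝ) 1, ‖deriv (fun s : ℝ => f ((1 - s) • x + s • y)) s‖ₑ := by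
        simpa using enorm_sub_le_lintegral_deriv_of_contDiffOn_Icc
          (f := fun s : ℝ => f ((1 - s) • x + s • y)) (ContDiff.contDiffOn (by fun_prop))
          zero_le_one
    _ ≤ ∫⁻ s in Icc (0 : ℝ) 1, Metric.ediam B * ‖fderiv ℝ f ((1 - s) • x + s • y)‖ₑ := by
        gcongr with s
        rw [(hderiv s).deriv, mul_comm]
        refine (ContinuousLinearMap.le_opENorm _ _).trans ?_
        gcongr
        rw [← edist_eq_enorm_sub]
        exact Metric.edist_le_ediam_of_mem hy hx
    _ = _ := lintegral_const_mul _
        ((hf.continuous_fderiv one_ne_zero).comp (by fun_prop)).enorm.measurable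

variable [FiniteDimensional ℝ E] [MeasurableSpace E] [BorelSpace E]
  (μ : Measure E) [μ.IsAddHaarMeasure]

theorem lintegral_comp_add_smul {H : E → ℝ≥0∞} (hH : Measurable H) {s : ℝ} (hs : 0 < s) (a : E) :
    ∫⁻ y, H (a + s • y) ∂μ = ENNReal.ofReal ((s ^ finrank ℝ E)⁻¹) * ∫⁻ y, H y ∂μ := by
  calc ∫⁻ y, H (a + s • y) ∂μ = ∫⁻ y, H (a + y) ∂(μ.map (s • ·)) := by
        rw [lintegral_map (by fun_prop) (by fun_prop)]
    _ = _ := by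
        rw [map_addHaar_smul _ hs.ne', lintegral_smul_measure, lintegral_add_left_eq_self,
          abs_of_pos (by positivity), smul_eq_mul]

theorem lintegral_convexComb_le {B : Set E} (hB : MeasurableSet B) (hconv : Convex ℝ B)
    {H : E → ℝ≥0∞} (hH : Measurable H) {s : ℝ} (hs : 1 / 2 ≤ s) (hs₁ : s ≤ 1) {x : E}
    (hx : x ∈ B) :
    ∫⁻ y in B, H ((1 - s) • x + s • y) ∂μ ≤ 2 ^ finrank ℝ E * ∫⁻ y in B, H y ∂μ := by
  have hs₀ : 0 < s := by linarith
  have hscale : ENNReal.ofReal ((s ^ finrank ℝ E)⁻¹) ≤ 2 ^ finrank ℝ E := by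
    rw [← inv_pow, ENNReal.ofReal_pow (by positivity)]
    gcongr
    rw [ENNReal.ofReal_le_ofNat]
    simpa using inv_anti₀ one_half_pos hs
  calc ∫⁻ y in B, H ((1 - s) • x + s • y) ∂μ
      ≤ ∫⁻ y in B, B.indicator H ((1 - s) • x + s • y) ∂μ := by
        refine setLIntegral_mono' hB fun y hy => ?_
        rw [indicator_of_mem (hconv hx hy (by linarith) hs₀.le (by ring))]
    _ ≤ ∫⁻ y, B.indicator H ((1 - s) • x + s • y) ∂μ := setLIntegral_le_lintegral _ _
    _ = ENNReal.ofReal ((s ^ finrank ℝ E)⁻¹) * ∫⁻ y in B, H y ∂μ := by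
        rw [lintegral_comp_add_smul μ (hH.indicator hB) hs₀, lintegral_indicator hB]
    _ ≤ _ := by gcongr

theorem lintegral_lintegral_segment_le {B : Set E} (hB : MeasurableSet B) (hconv : Convex ℝ B)
    {H : E → ℝ≥0∞} (hH : Measurable H) {s : ℝ} (hs : 0 ≤ s) (hs₁ : s ≤ 1) :
    ∫⁻ x in B, ∫⁻ y in B, H ((1 - s) • x + s • y) ∂μ ∂μ ≤
      2 ^ finrank ℝ E * μ B * ∫⁻ y in B, H y ∂μ := by
  rw [mul_right_comm, ← setLIntegral_const]
  rcases le_total (1 / 2) s with hhalf | hhalf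
  · exact setLIntegral_mono' hB fun x hx => lintegral_convexComb_le μ hB hconv hH hhalf hs₁ hx
  · rw [lintegral_lintegral_swap (by fun_prop)]
    refine setLIntegral_mono' hB fun y hy => ?_
    simpa only [sub_sub_cancel, add_comm] using
      lintegral_convexComb_le μ hB hconv hH (s := 1 - s) (by linarith) (by linarith) hy

theorem lintegral_enorm_sub_le_lintegral_fderiv (hB : MeasurableSet B) (hconv : Convex ℝ B)
    (hf : ContDiff ℝ 1 f) :
    ∫⁻ x in B, ∫⁻ y in B, ‖f y - f x‖ₑ ∂μ ∂μ ≤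
      Metric.ediam B * (2 ^ finrank ℝ E * μ B) * ∫⁻ x in B, ‖fderiv ℝ f x‖ₑ ∂μ := by
  have hH : Measurable fun x => ‖fderiv ℝ f x‖ₑ :=
    (hf.continuous_fderiv one_ne_zero).enorm.measurable
  set H := fun x => ‖fderiv ℝ f x‖ₑ
  calc ∫⁻ x in B, ∫⁻ y in B, ‖f y - f x‖ₑ ∂μ ∂μ
      ≤ ∫⁻ x in B, ∫⁻ y in B, Metric.ediam B *
          (∫⁻ s in Icc (0 : ℝ) 1, H ((1 - s) • x + s • y)) ∂μ ∂μ :=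
        setLIntegral_mono' hB fun x hx => setLIntegral_mono' hB fun y hy =>
          enorm_sub_le_lintegral_segment hf hx hy
    _ = ∫⁻ x in B, Metric.ediam B *
          (∫⁻ s in Icc (0 : ℝ) 1, ∫⁻ y in B, H ((1 - s) • x + s • y) ∂μ) ∂μ :=
        lintegral_congr fun x => by
          rw [lintegral_const_mul _ (by fun_prop), lintegral_lintegral_swap (by fun_prop)]
    _ = Metric.ediam B *
          ∫⁻ s in Icc (0 : ℝ) 1, (∫⁻ x in B, ∫⁻ y in B, H ((1 - s) • x + s • y) ∂μ ∂μ) := by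
        rw [lintegral_const_mul _ (by fun_prop), lintegral_lintegral_swap (by fun_prop)]
    _ ≤ Metric.ediam B * ∫⁻ s in Icc (0 : ℝ) 1, (2 ^ finrank ℝ E * μ B * ∫⁻ x in B, H x ∂μ) := by
        refine mul_le_mul_right ?_ _
        exact setLIntegral_mono' measurableSet_Icc fun s hs =>
          lintegral_lintegral_segment_le μ hB hconv hH hs.1 hs.2
    _ = _ := by
        rw [setLIntegral_const, Real.volume_Icc]
        simp [mul_assoc]

end Oscillation

section Approximation

open Filter Topology Convolution ContinuousLinearMap

/- Fatou's lemma for `‖H n‖ + ‖G‖ - ‖H n - G‖`. -/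
theorem tendsto_lintegral_enorm_sub_of_lintegral_enorm_le {α F : Type*} [MeasurableSpace α]
    {μ : Measure α} [NormedAddCommGroup F] {H : ℕ → α → F} {G : α → F}
    (hH : ∀ n, AEStronglyMeasurable (H n) μ) (hG : Integrable G μ)
    (hle : ∀ n, ∫⁻ z, ‖H n z‖ₑ ∂μ ≤ ∫⁻ z, ‖G z‖ₑ ∂μ)
    (hlim : ∀ᵐ z ∂μ, Tendsto (fun n => H n z) atTop (𝓝 (G z))) :
    Tendsto (fun n => ∫⁻ z, ‖H n z - G z‖ₑ ∂μ) atTop (𝓝 0) := by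
  set I := ∫⁻ z, ‖G z‖ₑ ∂μ
  have hII_top : I + I ≠ ∞ := ENNReal.add_ne_top.2 ⟨hG.2.ne, hG.2.ne⟩
  have hsub_le (n : ℕ) (z : α) : ‖H n z - G z‖ₑ ≤ ‖H n z‖ₑ + ‖G z‖ₑ := enorm_sub_le
  have hdiff_meas (n : ℕ) : AEMeasurable (fun z => ‖H n z - G z‖ₑ) μ := ((hH n).sub hG.1).enorm
  have hdiff_le (n : ℕ) : ∫⁻ z, ‖H n z - G z‖ₑ ∂μ ≤ I + I := by
    refine (lintegral_mono (hsub_le n)).trans ?_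
    rw [lintegral_add_left' (hH n).enorm]
    gcongr
    exact hle n
  have hfatou : I + I ≤ liminf (fun n => I + I - ∫⁻ z, ‖H n z - G z‖ₑ ∂μ) atTop := calc
    I + I = ∫⁻ z, ‖G z‖ₑ + ‖G z‖ₑ - ‖(0 : F)‖ₑ ∂μ := by
      simp only [enorm_zero, tsub_zero]
      rw [lintegral_add_left' hG.1.enorm]
    _ = ∫⁻ z, liminf (fun n => ‖H n z‖ₑ + ‖G z‖ₑ - ‖H n z - G z‖ₑ) atTop ∂μ := by
      refine lintegral_congr_ae ?_
      filter_upwards [hlim] with z hz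
      have hdiff : Tendsto (fun n => H n z - G z) atTop (𝓝 0) := by
        simpa using hz.sub_const (G z)
      exact (ENNReal.Tendsto.sub (hz.enorm.add_const _) hdiff.enorm
        (Or.inl (by simp))).liminf_eq.symm
    _ ≤ liminf (fun n => ∫⁻ z, ‖H n z‖ₑ + ‖G z‖ₑ - ‖H n z - G z‖ₑ ∂μ) atTop :=
      lintegral_liminf_le' fun n =>
        ((hH n).enorm.add hG.1.enorm).sub (hdiff_meas n)
    _ ≤ liminf (fun n => I + I - ∫⁻ z, ‖H n z - G z‖ₑ ∂μ) atTop := by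
      refine liminf_le_liminf (.of_forall fun n => ?_)
      rw [lintegral_sub' (hdiff_meas n) (ne_top_of_le_ne_top hII_top (hdiff_le n))
        (.of_forall (hsub_le n)), lintegral_add_left' (hH n).enorm]
      gcongr
      exact hle n
  rw [ENNReal.liminf_const_sub _ _ hII_top] at hfatou
  have hlimsup : limsup (fun n => ∫⁻ z, ‖H n z - G z‖ₑ ∂μ) atTop + (I + I) ≤ 0 + (I + I) := by
    rw [zero_add]
    exact add_le_of_le_tsub_left_of_le (limsup_le_of_le (h := .of_forall hdiff_le)) hfatou
  exact tendsto_of_le_liminf_of_limsup_le bot_le (ENNReal.le_of_add_le_add_right hII_top hlimsup)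

section Mollification

/-- The mollifiers used for smoothing: bump functions at the origin of outer radius `1 / (n + 1)`
and inner radius half of it. -/
noncomputable def shrinkingBump (E : Type*) [NormedAddCommGroup E] (n : ℕ) :
    ContDiffBump (0 : E) where
  rIn := 1 / ((n : ℝ) + 1) / 2
  rOut := 1 / ((n : ℝ) + 1)
  rIn_pos := by positivity
  rIn_lt_rOut := half_lt_self (by positivity)

theorem tendsto_shrinkingBump_rOut (E : Type*) [NormedAddCommGroup E] :
    Tendsto (fun n => (shrinkingBump E n).rOut) atTop (𝓝 0) :=
  tendsto_one_div_add_atTop_nhds_zero_nat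

variable {E F : Type*} [NormedAddCommGroup E] [NormedSpace ℝ E] [FiniteDimensional ℝ E]
  [MeasurableSpace E] [BorelSpace E] {μ : Measure E} [μ.IsAddHaarMeasure]
  [NormedAddCommGroup F] [NormedSpace ℝ F]

theorem ae_tendsto_shrinkingBump_convolution [CompleteSpace F] {g : E → F}
    (hg : LocallyIntegrable g μ) :
    ∀ᵐ z ∂μ, Tendsto
      (fun n => ((shrinkingBump E n).normed μ ⋆[lsmul ℝ ℝ, μ] g) z) atTop (𝓝 (g z)) :=
  ContDiffBump.ae_convolution_tendsto_right_of_locallyIntegrable (K := 2) (μ := μ)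
    (tendsto_shrinkingBump_rOut E)
    (.of_forall fun n => (mul_div_cancel₀ (1 / ((n : ℝ) + 1)) two_ne_zero).ge) hg

theorem lintegral_enorm_bump_convolution_le (η : ContDiffBump (0 : E)) {g : E → F}
    (hg : Integrable g μ) :
    ∫⁻ z, ‖(η.normed μ ⋆[lsmul ℝ ℝ, μ] g) z‖ₑ ∂μ ≤ ∫⁻ z, ‖g z‖ₑ ∂μ := by
  have hnorm (z t : E) : ‖lsmul ℝ ℝ (η.normed μ t) (g (z - t))‖ =
      lsmul ℝ ℝ (η.normed μ t) ‖g (z - t)‖ := by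
    simp [norm_smul, abs_of_nonneg (η.nonneg_normed t)]
  have hint : Integrable (η.normed μ ⋆[lsmul ℝ ℝ, μ] fun z => ‖g z‖) μ :=
    η.integrable_normed.integrable_convolution _ hg.norm
  calc ∫⁻ z, ‖(η.normed μ ⋆[lsmul ℝ ℝ, μ] g) z‖ₑ ∂μ
      ≤ ∫⁻ z, ENNReal.ofReal ((η.normed μ ⋆[lsmul ℝ ℝ, μ] fun z => ‖g z‖) z) ∂μ := by
        refine lintegral_mono fun z => ?_
        rw [← ofReal_norm]
        refine ENNReal.ofReal_le_ofReal ((norm_integral_le_integral_norm _).trans_eq ?_)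
        simp only [convolution_def, hnorm]
    _ = ENNReal.ofReal (∫ z, (η.normed μ ⋆[lsmul ℝ ℝ, μ] fun z => ‖g z‖) z ∂μ) :=
        (ofReal_integral_eq_lintegral_ofReal hint (.of_forall fun z => integral_nonneg fun t =>
          (norm_nonneg _).trans_eq (hnorm z t))).symm
    _ = ∫⁻ z, ‖g z‖ₑ ∂μ := by
        rw [integral_convolution _ η.integrable_normed hg.norm, η.integral_normed, lsmul_apply,
          one_smul, ofReal_integral_norm_eq_lintegral_enorm hg]

theorem tendsto_lintegral_enorm_shrinkingBump_convolution_sub [CompleteSpace F] {g : E → F}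
    (hg : Integrable g μ) :
    Tendsto (fun n => ∫⁻ z, ‖((shrinkingBump E n).normed μ ⋆[lsmul ℝ ℝ, μ] g) z - g z‖ₑ ∂μ)
      atTop (𝓝 0) :=
  tendsto_lintegral_enorm_sub_of_lintegral_enorm_le
    (fun n => ((shrinkingBump E n).integrable_normed.integrable_convolution _ hg).1) hg
    (fun _ => lintegral_enorm_bump_convolution_le _ hg)
    (ae_tendsto_shrinkingBump_convolution hg.locallyIntegrable)

theorem fderiv_convolution_apply {η g : E → ℝ} (hη : ContDiff ℝ 1 η) (hηc : HasCompactSupport η)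
    (hg : LocallyIntegrable g μ) (z v : E) :
    fderiv ℝ (η ⋆[lsmul ℝ ℝ, μ] g) z v = -∫ t, g t * fderiv ℝ (fun s => η (z - s)) t v ∂μ := by
  have hint : Integrable (fun t => (lsmul ℝ ℝ).precompL E (fderiv ℝ η (z - t)) (g t)) μ :=
    ((hηc.fderiv ℝ).convolutionExists_left _ (hη.continuous_fderiv one_ne_zero)
      hg z).integrable_swap
  rw [(hηc.hasFDerivAt_convolution_left _ hη hg z).fderiv, convolution_eq_swap,
    ContinuousLinearMap.integral_apply hint, ← integral_neg]
  refine integral_congr_ae (.of_forall fun t => ?_)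
  have hsub : HasFDerivAt (fun s => η (z - s)) ((fderiv ℝ η (z - t)).comp (-.id ℝ E)) t :=
    ((hη.differentiable one_ne_zero) _).hasFDerivAt.comp t ((hasFDerivAt_id t).const_sub z)
  simp [hsub.fderiv, precompL_apply, mul_comm]

theorem inner_convolution {H : Type*} [NormedAddCommGroup H] [InnerProductSpace ℝ H]
    [CompleteSpace H] {η : E → ℝ} {G : E → H} (hη : Continuous η) (hηc : HasCompactSupport η)
    (hG : LocallyIntegrable G μ) (z : E) (e : H) :
    inner ℝ ((η ⋆[lsmul ℝ ℝ, μ] G) z) e = ∫ t, η (z - t) * inner ℝ (G t) e ∂μ := by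
  have hint : Integrable (fun t => η (z - t) • G t) μ :=
    (hηc.convolutionExists_left (lsmul ℝ ℝ) hη hG z).integrable_swap
  rw [convolution_eq_swap, real_inner_comm]
  simp only [lsmul_apply]
  rw [← integral_inner hint]
  simp only [inner_smul_right, real_inner_comm]

end Mollification

section WeakGradient

variable {d : ℕ} {Q K : Set (ℝ × Space d)} {w : ℝ × Space d → ℝ} {G : ℝ × Space d → Space d}

instance isAddHaarMeasure_volume_spaceTime (d : ℕ) :
    (volume : Measure (ℝ × Space d)).IsAddHaarMeasure :=
  Measure.prod.instIsAddHaarMeasure _ _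

theorem HasWeakSpatialGradient.integral_indicator_mul_fderiv (h : HasWeakSpatialGradient Q w G)
    (hQ : IsOpen Q) (hK : IsCompact K) (hKQ : K ⊆ Q) {φ : ℝ × Space d → ℝ}
    (hφ : ContDiff ℝ ((⊤ : ℕ∞) : WithTop ℕ∞) φ) (hφK : tsupport φ ⊆ K) (e : Space d) :
    ∫ z, K.indicator w z * fderiv ℝ φ z (0, e) =
      -∫ z, φ z * inner ℝ (K.indicator G z) e := by
  have hleft : ∫ z in Q, w z * fderiv ℝ φ z (0, e) =
      ∫ z, K.indicator w z * fderiv ℝ φ z (0, e) := by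
    rw [← integral_indicator hQ.measurableSet]
    refine integral_congr_ae (.of_forall fun z => ?_)
    by_cases hz : z ∈ K
    · simp [hKQ hz, hz]
    · simp [hz, fderiv_of_notMem_tsupport (𝕜 := ℝ) fun hz' => hz (hφK hz')]
  have hright : ∫ z in Q, φ z * inner ℝ (G z) e =
      ∫ z, φ z * inner ℝ (K.indicator G z) e := by
    rw [← integral_indicator hQ.measurableSet]
    refine integral_congr_ae (.of_forall fun z => ?_)
    by_cases hz : z ∈ K
    · simp [hKQ hz, hz]
    · simp [hz, image_eq_zero_of_notMem_tsupport fun hz' => hz (hφK hz')]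
  rw [← hleft, ← hright]
  exact h.2.2 φ hφ (hK.of_isClosed_subset (isClosed_tsupport φ) hφK) (hφK.trans hKQ) e

theorem HasWeakSpatialGradient.integrable_indicator (h : HasWeakSpatialGradient Q w G)
    (hK : IsCompact K) (hKQ : K ⊆ Q) :
    Integrable (K.indicator w) volume ∧ Integrable (K.indicator G) volume :=
  ⟨(integrable_indicator_iff hK.measurableSet).2 (h.1.integrableOn_compact_subset hKQ hK),
    (integrable_indicator_iff hK.measurableSet).2 (h.2.1.integrableOn_compact_subset hKQ hK)⟩

theorem HasWeakSpatialGradient.fderiv_convolution (h : HasWeakSpatialGradient Q w G)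
    (hQ : IsOpen Q) (hK : IsCompact K) (hKQ : K ⊆ Q) {η : ℝ × Space d → ℝ}
    (hη : ContDiff ℝ ((⊤ : ℕ∞) : WithTop ℕ∞) η) (hηc : HasCompactSupport η)
    {z : ℝ × Space d} (hz : ∀ z', z - z' ∈ tsupport η → z' ∈ K) (e : Space d) :
    fderiv ℝ (η ⋆[lsmul ℝ ℝ, volume] K.indicator w) z (0, e) =
      inner ℝ ((η ⋆[lsmul ℝ ℝ, volume] K.indicator G) z) e := by
  obtain ⟨hw, hG⟩ := h.integrable_indicator hK hKQ
  have hsupp : tsupport (fun z' => η (z - z')) ⊆ K :=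
    closure_minimal (fun z' hz' => hz z' (subset_tsupport _ hz')) hK.isClosed
  rw [fderiv_convolution_apply (hη.of_le (by exact_mod_cast le_top)) hηc hw.locallyIntegrable,
    inner_convolution hη.continuous hηc hG.locallyIntegrable,
    h.integral_indicator_mul_fderiv hQ hK hKQ (by fun_prop) hsupp, neg_neg]

theorem HasWeakSpatialGradient.exists_smooth_approximation (h : HasWeakSpatialGradient Q w G)
    (hQ : IsOpen Q) (hK : IsCompact K) (hKQ : K ⊆ Q) :
    ∃ (f : ℕ → ℝ × Space d → ℝ) (H : ℕ → ℝ × Space d → Space d),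
      (∀ n, ContDiff ℝ 1 (f n)) ∧ (∀ n, Continuous (H n)) ∧
      (∀ᶠ n in atTop, ∀ z ∈ K, ∀ e, fderiv ℝ (f n) z (0, e) = inner ℝ (H n z) e) ∧
      (∀ᵐ z ∂volume.restrict K, Tendsto (fun n => f n z) atTop (𝓝 (w z))) ∧
      Tendsto (fun n => ∫⁻ z in K, ‖H n z - G z‖ₑ) atTop (𝓝 0) := by
  obtain ⟨δ, hδ, hδQ⟩ := hK.exists_cthickening_subset_open hQ hKQ
  set K₁ := Metric.cthickening δ K
  have hK₁ : IsCompact K₁ := hK.cthickening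
  have hKK₁ : K ⊆ K₁ := Metric.self_subset_cthickening K
  obtain ⟨hw, hG⟩ := h.integrable_indicator hK₁ hδQ
  let η (n : ℕ) : ℝ × Space d → ℝ := (shrinkingBump (ℝ × Space d) n).normed volume
  have hη (n : ℕ) : ContDiff ℝ ((⊤ : ℕ∞) : WithTop ℕ∞) (η n) := ContDiffBump.contDiff_normed _
  have hηc (n : ℕ) : HasCompactSupport (η n) := ContDiffBump.hasCompactSupport_normed _
  refine ⟨fun n => η n ⋆[lsmul ℝ ℝ, volume] K₁.indicator w,
    fun n => η n ⋆[lsmul ℝ ℝ, volume] K₁.indicator G, fun n => ?_, fun n => ?_, ?_, ?_, ?_⟩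
  · exact ((hηc n).contDiff_convolution_left _ (hη n) hw.locallyIntegrable).of_le
      (by exact_mod_cast le_top)
  · exact (hηc n).continuous_convolution_left _ (hη n).continuous hG.locallyIntegrable
  · filter_upwards [(tendsto_shrinkingBump_rOut (ℝ × Space d)).eventually (gt_mem_nhds hδ)]
      with n hn z hz e
    refine h.fderiv_convolution hQ hK₁ hδQ (hη n) (hηc n) (fun z' hz' => ?_) e
    rw [ContDiffBump.tsupport_normed_eq, Metric.mem_closedBall, dist_zero_right, ← dist_eq_norm,
      dist_comm] at hz'
    exact Metric.mem_cthickening_of_dist_le z' z δ K hz (hz'.trans hn.le)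
  · filter_upwards [ae_restrict_of_ae (ae_tendsto_shrinkingBump_convolution hw.locallyIntegrable),
      ae_restrict_mem hK.measurableSet] with z hz hzK
    rwa [indicator_of_mem (hKK₁ hzK)] at hz
  · refine tendsto_of_tendsto_of_tendsto_of_le_of_le tendsto_const_nhds
      (tendsto_lintegral_enorm_shrinkingBump_convolution_sub hG) (fun _ => zero_le) fun n => ?_
    refine (setLIntegral_mono' hK.measurableSet fun z hz => ?_).trans
      (setLIntegral_le_lintegral K _)
    rw [indicator_of_mem (hKK₁ hz)]

end WeakGradient

end Approximation

section Isoperimetric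

open Filter Topology

theorem exists_contDiff_step : ∃ M : ℝ, 0 < M ∧ ∀ lam : ℝ, 0 < lam → ∃ φ : ℝ → ℝ,
    ContDiff ℝ 1 φ ∧ (∀ r ≤ 0, φ r = 0) ∧ (∀ r, lam ≤ r → φ r = 1) ∧
      ∀ r, |deriv φ r| ≤ (Ioo 0 lam).indicator (fun _ => M / lam) r := by
  obtain ⟨M, hM⟩ := isCompact_Icc.exists_bound_of_continuousOn (s := Icc (0 : ℝ) 1)
    (Real.smoothTransition.contDiff.continuous_deriv (n := 1) le_rfl).continuousOn
  refine ⟨max M 1, by positivity, fun lam hlam =>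
    ⟨fun r => Real.smoothTransition (r / lam), Real.smoothTransition.contDiff.comp (by fun_prop),
      fun r hr => Real.smoothTransition.zero_of_nonpos (div_nonpos_of_nonpos_of_nonneg hr hlam.le),
      fun r hr => Real.smoothTransition.one_of_one_le ((one_le_div hlam).2 hr), fun r => ?_⟩⟩
  by_cases hr : r ∈ Ioo 0 lam
  · have hderiv : deriv (fun r => Real.smoothTransition (r / lam)) r =
        deriv Real.smoothTransition (r / lam) / lam := by
      simpa [div_eq_inv_mul] using
        deriv_comp_mul_left lam⁻¹ Real.smoothTransition r
    rw [indicator_of_mem hr, hderiv, abs_div, abs_of_pos hlam]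
    gcongr
    exact (hM _ ⟨(div_pos hr.1 hlam).le, (div_le_one hlam).2 hr.2.le⟩).trans (le_max_left _ _)
  · rw [indicator_of_notMem hr, abs_nonpos_iff]
    rcases le_or_gt r 0 with hr0 | hr0
    · refine IsLocalMin.deriv_eq_zero (.of_forall fun s => ?_)
      simp only [Real.smoothTransition.zero_of_nonpos (div_nonpos_of_nonpos_of_nonneg hr0 hlam.le)]
      exact Real.smoothTransition.nonneg _
    · have hr1 : lam ≤ r := not_lt.1 fun h => hr ⟨hr0, h⟩
      refine IsLocalMax.deriv_eq_zero (.of_forall fun s => ?_)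
      simp only [Real.smoothTransition.one_of_one_le ((one_le_div hlam).2 hr1)]
      exact Real.smoothTransition.le_one _

variable {d : ℕ} {I : Set ℝ} {B : Set (Space d)}

theorem ae_ae_of_ae_restrict_prod {P : ℝ × Space d → Prop}
    (h : ∀ᵐ z ∂volume.restrict (I ×ˢ B), P z) :
    ∀ᵐ t ∂volume.restrict I, ∀ᵐ x ∂volume.restrict B, P (t, x) := by
  rw [Measure.volume_eq_prod, ← Measure.prod_restrict] at h
  exact Measure.ae_ae_of_ae_prod h

/-- The `L¹` oscillation in space of a function on space-time, integrated over the times in `I`. -/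
noncomputable def spatialOscillation (I : Set ℝ) (B : Set (Space d)) (g : ℝ × Space d → ℝ) :
    ℝ≥0∞ :=
  ∫⁻ t in I, ∫⁻ x in B, ∫⁻ y in B, ‖g (t, y) - g (t, x)‖ₑ

theorem spatialOscillation_le_liminf {g : ℕ → ℝ × Space d → ℝ} {g' : ℝ × Space d → ℝ}
    (hg : ∀ n, Measurable (g n))
    (hlim : ∀ᵐ z ∂volume.restrict (I ×ˢ B), Tendsto (fun n => g n z) atTop (𝓝 (g' z))) :
    spatialOscillation I B g' ≤ liminf (fun n => spatialOscillation I B (g n)) atTop := by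
  have hdiff (n : ℕ) : Measurable fun q : (ℝ × Space d) × Space d =>
      ‖g n (q.1.1, q.2) - g n q.1‖ₑ :=
    (((hg n).comp (by fun_prop)).sub ((hg n).comp measurable_fst)).enorm
  have hslice (n : ℕ) : Measurable fun z : ℝ × Space d => ∫⁻ y in B, ‖g n (z.1, y) - g n z‖ₑ :=
    (hdiff n).lintegral_prod_right'
  refine (lintegral_mono_ae ?_).trans
    (lintegral_liminf_le' fun n => (hslice n).lintegral_prod_right'.aemeasurable)
  filter_upwards [ae_ae_of_ae_restrict_prod hlim] with t ht
  refine (lintegral_mono_ae ?_).trans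
    (lintegral_liminf_le' fun n => ((hslice n).comp measurable_prodMk_left).aemeasurable)
  filter_upwards [ht] with x hx
  refine (lintegral_mono_ae ?_).trans
    (lintegral_liminf_le' fun n =>
      ((hdiff n).comp (measurable_prodMk_left (x := (t, x)))).aemeasurable)
  filter_upwards [ht] with y hy
  exact (hy.sub hx).enorm.liminf_eq.ge

theorem setLIntegral_prod {g : ℝ × Space d → ℝ≥0∞}
    (hg : AEMeasurable g (volume.restrict (I ×ˢ B))) :
    ∫⁻ z in I ×ˢ B, g z = ∫⁻ t in I, ∫⁻ x in B, g (t, x) := by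
  rw [Measure.volume_eq_prod, ← Measure.prod_restrict] at hg ⊢
  exact lintegral_prod g hg

theorem lintegral_enorm_comp_sub_le_of_fderiv_eq_inner {f : ℝ × Space d → ℝ}
    {H : ℝ × Space d → Space d} {φ : ℝ → ℝ} (hφ : ContDiff ℝ 1 φ) (hf : ContDiff ℝ 1 f)
    (hB : MeasurableSet B) (hconv : Convex ℝ B) {t : ℝ}
    (hfH : ∀ x ∈ B, ∀ e, fderiv ℝ f (t, x) (0, e) = inner ℝ (H (t, x)) e) :
    ∫⁻ x in B, ∫⁻ y in B, ‖φ (f (t, y)) - φ (f (t, x))‖ₑ ≤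
      Metric.ediam B * (2 ^ d * volume B) *
        ∫⁻ x in B, ‖deriv φ (f (t, x))‖ₑ * ‖H (t, x)‖ₑ := by
  have hderiv (x : Space d) : HasFDerivAt (fun x => φ (f (t, x)))
      (deriv φ (f (t, x)) • (fderiv ℝ f (t, x)).comp (.inr ℝ ℝ (Space d))) x :=
    (hφ.differentiable one_ne_zero _).hasDerivAt.comp_hasFDerivAt x
      ((hf.differentiable one_ne_zero _).hasFDerivAt.comp x (hasFDerivAt_prodMk_right t x))
  have hnorm (x : Space d) (hx : x ∈ B) :
      ‖fderiv ℝ (fun x => φ (f (t, x))) x‖ₑ ≤ ‖deriv φ (f (t, x))‖ₑ * ‖H (t, x)‖ₑ := by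
    rw [(hderiv x).fderiv, enorm_smul]
    gcongr
    rw [enorm_le_iff_norm_le]
    refine ContinuousLinearMap.opNorm_le_bound _ (norm_nonneg _) fun e => ?_
    simpa [hfH x hx e] using norm_inner_le_norm (𝕜 := ℝ) (H (t, x)) e
  refine (lintegral_enorm_sub_le_lintegral_fderiv volume hB hconv
    (hφ.comp (hf.comp (by fun_prop : ContDiff ℝ 1 fun x : Space d => (t, x))))).trans ?_
  rw [finrank_euclideanSpace_fin]
  exact mul_le_mul_right (setLIntegral_mono' hB hnorm) _

theorem limsup_lintegral_enorm_comp_mul_enorm_le {α : Type*} [MeasurableSpace α] {μ : Measure α}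
    {F : Type*} [NormedAddCommGroup F] {ψ : ℝ → ℝ} (hψ : Continuous ψ) {M : ℝ} (hM : ∀ r, |ψ r| ≤ M)
    {f : ℕ → α → ℝ} {w : α → ℝ} {H : ℕ → α → F} {G : α → F} (hf : ∀ n, AEMeasurable (f n) μ)
    (hG : Integrable G μ) (hfw : ∀ᵐ z ∂μ, Tendsto (fun n => f n z) atTop (𝓝 (w z)))
    (hHG : Tendsto (fun n => ∫⁻ z, ‖H n z - G z‖ₑ ∂μ) atTop (𝓝 0)) :
    limsup (fun n => ∫⁻ z, ‖ψ (f n z)‖ₑ * ‖H n z‖ₑ ∂μ) atTop ≤ ∫⁻ z, ‖ψ (w z)‖ₑ * ‖G z‖ₑ ∂μ := by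
  have hψM (r : ℝ) : ‖ψ r‖ₑ ≤ ENNReal.ofReal M := by
    rw [← ofReal_norm, Real.norm_eq_abs]
    exact ENNReal.ofReal_le_ofReal (hM r)
  have hmeas (n : ℕ) : AEMeasurable (fun z => ‖ψ (f n z)‖ₑ * ‖G z‖ₑ) μ :=
    (hψ.measurable.comp_aemeasurable (hf n)).enorm.mul hG.1.enorm
  have hle (n : ℕ) : ∫⁻ z, ‖ψ (f n z)‖ₑ * ‖H n z‖ₑ ∂μ ≤
      ∫⁻ z, ‖ψ (f n z)‖ₑ * ‖G z‖ₑ ∂μ + ENNReal.ofReal M * ∫⁻ z, ‖H n z - G z‖ₑ ∂μ := by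
    rw [← lintegral_const_mul' _ _ ENNReal.ofReal_ne_top, ← lintegral_add_left' (hmeas n)]
    refine lintegral_mono fun z => ?_
    calc ‖ψ (f n z)‖ₑ * ‖H n z‖ₑ ≤ ‖ψ (f n z)‖ₑ * (‖G z‖ₑ + ‖H n z - G z‖ₑ) := by
          gcongr
          simpa using enorm_add_le (G z) (H n z - G z)
      _ ≤ _ := by
          rw [mul_add]
          gcongr
          exact hψM _
  have hdom : Tendsto (fun n => ∫⁻ z, ‖ψ (f n z)‖ₑ * ‖G z‖ₑ ∂μ) atTop
      (𝓝 (∫⁻ z, ‖ψ (w z)‖ₑ * ‖G z‖ₑ ∂μ)) := by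
    refine tendsto_lintegral_of_dominated_convergence' (fun z => ENNReal.ofReal M * ‖G z‖ₑ) hmeas
      (fun n => .of_forall fun z => mul_le_mul_left (hψM _) _) ?_ ?_
    · rw [lintegral_const_mul' _ _ ENNReal.ofReal_ne_top]
      exact ENNReal.mul_ne_top ENNReal.ofReal_ne_top hG.2.ne
    · filter_upwards [hfw] with z hz
      exact ENNReal.Tendsto.mul_const ((hψ.tendsto _).comp hz).enorm (Or.inr enorm_ne_top)
  have hbound := hdom.add
    (ENNReal.Tendsto.const_mul hHG (Or.inr (ENNReal.ofReal_ne_top (r := M))))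
  rw [mul_zero, add_zero] at hbound
  exact (limsup_le_limsup (.of_forall hle)).trans hbound.limsup_eq.le

theorem HasWeakSpatialGradient.spatialOscillation_comp_le {Q K : Set (ℝ × Space d)}
    {w : ℝ × Space d → ℝ} {G : ℝ × Space d → Space d} (h : HasWeakSpatialGradient Q w G)
    (hQ : IsOpen Q) (hK : IsCompact K) (hKQ : K ⊆ Q) (hI : MeasurableSet I) (hB : MeasurableSet B)
    (hconv : Convex ℝ B) (hbdd : Bornology.IsBounded B) (hIB : I ×ˢ B ⊆ K) {φ : ℝ → ℝ}
    (hφ : ContDiff ℝ 1 φ) {M : ℝ} (hM : ∀ r, |deriv φ r| ≤ M) :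
    spatialOscillation I B (fun z => φ (w z)) ≤ Metric.ediam B * (2 ^ d * volume B) *
      ∫⁻ z in I ×ˢ B, ‖deriv φ (w z)‖ₑ * ‖G z‖ₑ := by
  obtain ⟨f, H, hf, hH, hfH, hfw, hHG⟩ := h.exists_smooth_approximation hQ hK hKQ
  have hfw' := ae_restrict_of_ae_restrict_of_subset hIB hfw
  set c := Metric.ediam B * (2 ^ d * volume B)
  have hc : c ≠ ∞ := ENNReal.mul_ne_top hbdd.ediam_ne_top
    (ENNReal.mul_ne_top (by finiteness) hbdd.measure_lt_top.ne)
  have hφ' : Continuous (deriv φ) := hφ.continuous_deriv le_rfl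
  have hsmooth : ∀ᶠ n in atTop, spatialOscillation I B (fun z => φ (f n z)) ≤
      c * ∫⁻ z in I ×ˢ B, ‖deriv φ (f n z)‖ₑ * ‖H n z‖ₑ := by
    filter_upwards [hfH] with n hn
    have hmeas : Measurable fun z => ‖deriv φ (f n z)‖ₑ * ‖H n z‖ₑ :=
      (hφ'.comp (hf n).continuous).measurable.enorm.mul (hH n).measurable.enorm
    rw [setLIntegral_prod hmeas.aemeasurable, ← lintegral_const_mul' _ _ hc]
    exact setLIntegral_mono' hI fun t ht => lintegral_enorm_comp_sub_le_of_fderiv_eq_inner hφ (hf n)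
      hB hconv fun x hx => hn _ (hIB ⟨ht, hx⟩)
  calc spatialOscillation I B (fun z => φ (w z))
      ≤ liminf (fun n => spatialOscillation I B (fun z => φ (f n z))) atTop := by
        refine spatialOscillation_le_liminf
          (fun n => (hφ.continuous.comp (hf n).continuous).measurable) ?_
        filter_upwards [hfw'] with z hz using (hφ.continuous.tendsto _).comp hz
    _ ≤ limsup (fun n => c * ∫⁻ z in I ×ˢ B, ‖deriv φ (f n z)‖ₑ * ‖H n z‖ₑ) atTop :=
        (liminf_le_liminf hsmooth).trans liminf_le_limsup
    _ ≤ c * ∫⁻ z in I ×ˢ B, ‖deriv φ (w z)‖ₑ * ‖G z‖ₑ := by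
        rw [ENNReal.limsup_const_mul_of_ne_top hc]
        gcongr
        refine limsup_lintegral_enorm_comp_mul_enorm_le hφ' hM
          (fun n => (hf n).continuous.aemeasurable)
          ((h.2.1.integrableOn_compact_subset hKQ hK).mono_set hIB) hfw' ?_
        exact tendsto_of_tendsto_of_tendsto_of_le_of_le tendsto_const_nhds hHG (fun _ => zero_le)
          fun n => lintegral_mono_set hIB

theorem measure_mul_measure_le_lintegral_enorm_sub {α : Type*} [MeasurableSpace α] {ν : Measure α}
    {w : α → ℝ} (hw : Measurable w) {lam : ℝ} {φ : ℝ → ℝ} (hφ₀ : ∀ r ≤ 0, φ r = 0)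
    (hφ₁ : ∀ r, lam ≤ r → φ r = 1) :
    ν {x | w x ≤ 0} * ν {x | lam ≤ w x} ≤ ∫⁻ x, ∫⁻ y, ‖φ (w y) - φ (w x)‖ₑ ∂ν ∂ν := by
  have hlow : MeasurableSet {x | w x ≤ 0} := measurableSet_le hw measurable_const
  have hhigh : MeasurableSet {x | lam ≤ w x} := measurableSet_le measurable_const hw
  calc ν {x | w x ≤ 0} * ν {x | lam ≤ w x}
      = ∫⁻ _ in {x | w x ≤ 0}, ∫⁻ _ in {x | lam ≤ w x}, 1 ∂ν ∂ν := by
        rw [setLIntegral_one, setLIntegral_const, mul_comm]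
    _ ≤ ∫⁻ x in {x | w x ≤ 0}, ∫⁻ y in {x | lam ≤ w x}, ‖φ (w y) - φ (w x)‖ₑ ∂ν ∂ν := by
        refine setLIntegral_mono' hlow fun x hx => setLIntegral_mono' hhigh fun y hy => ?_
        simp [hφ₀ _ hx, hφ₁ _ hy]
    _ ≤ ∫⁻ x, ∫⁻ y, ‖φ (w y) - φ (w x)‖ₑ ∂ν ∂ν :=
        (setLIntegral_le_lintegral _ _).trans
          (lintegral_mono fun x => setLIntegral_le_lintegral _ _)

theorem setLIntegral_enorm_le_sqrt {α F : Type*} [MeasurableSpace α] {μ : Measure α}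
    [NormedAddCommGroup F] {G : α → F} (hG : AEStronglyMeasurable G μ) {S : Set α}
    (hS : MeasurableSet S) :
    ∫⁻ z in S, ‖G z‖ₑ ∂μ ≤ ((∫⁻ z, ‖G z‖ₑ ^ 2 ∂μ) * μ S) ^ (1 / 2 : ℝ) := by
  have hholder := ENNReal.lintegral_mul_le_Lp_mul_Lq μ .two_two hG.enorm
    ((measurable_const (a := (1 : ℝ≥0∞))).indicator hS).aemeasurable
  rw [← lintegral_indicator hS, ENNReal.mul_rpow_of_nonneg _ _ (by norm_num),
    ← lintegral_indicator_one hS]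
  convert hholder using 2
  · congr with z
    by_cases hz : z ∈ S <;> simp [hz]
  · simp only [ENNReal.rpow_two]
  · congr with z
    by_cases hz : z ∈ S <;> simp [hz]

theorem exists_lintegral_measure_mul_measure_le :
    ∃ M : ℝ, 0 < M ∧ ∀ {d : ℕ} {Q K : Set (ℝ × Space d)} {I : Set ℝ} {B : Set (Space d)}
      {w : ℝ × Space d → ℝ} {G : ℝ × Space d → Space d} {lam : ℝ},
      HasWeakSpatialGradient Q w G → IsOpen Q → IsCompact K → K ⊆ Q → I ×ˢ B ⊆ K →
      MeasurableSet I → MeasurableSet B → Convex ℝ B → Bornology.IsBounded B →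
      Measurable w → 0 < lam →
      ∫⁻ t in I, volume.restrict B {x | w (t, x) ≤ 0} * volume.restrict B {x | lam ≤ w (t, x)} ≤
        Metric.ediam B * (2 ^ d * volume B) * (ENNReal.ofReal (M / lam) *
          ((∫⁻ z in I ×ˢ B, ‖G z‖ₑ ^ 2) *
            volume.restrict (I ×ˢ B) {z | 0 < w z ∧ w z < lam}) ^ (1 / 2 : ℝ)) := by
  obtain ⟨M, hM, hstep⟩ := exists_contDiff_step
  refine ⟨M, hM, fun {d Q K I B w G lam} h hQ hK hKQ hIB hI hB hconv hbdd hw hlam => ?_⟩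
  obtain ⟨φ, hφ, hφ₀, hφ₁, hφ'⟩ := hstep lam hlam
  have hφM (r : ℝ) : |deriv φ r| ≤ M / lam :=
    (hφ' r).trans (indicator_le_self' (fun _ _ => by positivity) r)
  have hmid : MeasurableSet {z | 0 < w z ∧ w z < lam} :=
    (measurableSet_lt measurable_const hw).inter (measurableSet_lt hw measurable_const)
  have hG : AEStronglyMeasurable G (volume.restrict (I ×ˢ B)) :=
    ((h.2.1.integrableOn_compact_subset hKQ hK).mono_set hIB).1
  calc ∫⁻ t in I, volume.restrict B {x | w (t, x) ≤ 0} * volume.restrict B {x | lam ≤ w (t, x)}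
      ≤ spatialOscillation I B (fun z => φ (w z)) :=
        lintegral_mono fun t => measure_mul_measure_le_lintegral_enorm_sub
          (hw.comp measurable_prodMk_left) hφ₀ hφ₁
    _ ≤ Metric.ediam B * (2 ^ d * volume B) *
          ∫⁻ z in I ×ˢ B, ‖deriv φ (w z)‖ₑ * ‖G z‖ₑ :=
        h.spatialOscillation_comp_le hQ hK hKQ hI hB hconv hbdd hIB hφ hφM
    _ ≤ _ := by
        gcongr
        refine le_trans ?_ (mul_le_mul_right (setLIntegral_enorm_le_sqrt hG hmid) _)
        rw [← lintegral_indicator hmid, ← lintegral_const_mul' _ _ ENNReal.ofReal_ne_top]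
        refine lintegral_mono fun z => ?_
        rw [← ofReal_norm (deriv φ (w z)), Real.norm_eq_abs]
        by_cases hz : z ∈ {z | 0 < w z ∧ w z < lam}
        · rw [indicator_of_mem hz]
          gcongr
          exact hφM _
        · have hderiv := (hφ' (w z)).trans_eq (indicator_of_notMem (s := Ioo 0 lam) hz _)
          simp [abs_nonpos_iff.1 hderiv]

end Isoperimetric

section Energy

theorem setLIntegral_Ioo_le_of_forall_lt {s b : ℝ} {F : ℝ → ℝ≥0∞} {M : ℝ≥0∞}
    (h : ∀ c < b, ∃ t, c ≤ t ∧ ∫⁻ τ in Ioo s t, F τ ≤ M) : ∫⁻ τ in Ioo s b, F τ ≤ M := by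
  obtain ⟨c, hc, hcb, hlim⟩ := exists_seq_strictMono_tendsto b
  have hunion : ⋃ n, Ioo s (c n) = Ioo s b :=
    iUnion_Ioo_of_mono_of_isGLB_of_isLUB antitone_const hc.monotone (by simp)
      (isLUB_of_tendsto_atTop hc.monotone hlim)
  rw [← hunion, setLIntegral_iUnion_of_directed]
  · refine iSup_le fun n => ?_
    obtain ⟨t, hct, ht⟩ := h (c n) (hcb n)
    exact (lintegral_mono_set (Ioo_subset_Ioo_right hct)).trans ht
  · exact Monotone.directed_le fun n m hnm => Ioo_subset_Ioo_right (hc.monotone hnm)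

theorem lintegral_lintegral_le_of_ae_le {α β : Type*} [MeasurableSpace α] [MeasurableSpace β]
    {μ : Measure α} {ν : Measure β} {g : α → β → ℝ≥0∞} {c : ℝ≥0∞}
    (h : ∀ᵐ a ∂μ, ∀ᵐ b ∂ν, g a b ≤ c) : ∫⁻ a, ∫⁻ b, g a b ∂ν ∂μ ≤ c * ν univ * μ univ := by
  rw [← lintegral_const]
  refine lintegral_mono_ae ?_
  filter_upwards [h] with a ha
  rw [← lintegral_const]
  exact lintegral_mono_ae ha

theorem le_mul_rpow_one_div {p y T : ℝ} (hp : 1 ≤ p) (hT : 1 ≤ T) (hy₀ : 0 ≤ y) (hyT : y ≤ T) :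
    y ≤ T * y ^ (1 / p) := by
  have hT₀ : 0 < T := one_pos.trans_le hT
  have hp₀ : 0 < p := one_pos.trans_le hp
  have hratio : y / T ≤ y ^ (1 / p) := calc
    y / T ≤ (y / T) ^ (1 / p) :=
      Real.self_le_rpow_of_le_one (by positivity) ((div_le_one hT₀).2 hyT) ((div_le_one hp₀).2 hp)
    _ ≤ y ^ (1 / p) := by gcongr; exact div_le_self hy₀ hT
  rwa [div_le_iff₀' hT₀] at hratio

variable {d : ℕ} {γ₁ γ₂ γ₃ p k m r R : ℝ} {u : ℝ × Space d → ℝ} {G : ℝ × Space d → Space d}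

/-- The factor of `(t - s) ^ (1 / p)` in a bound for the two lower-order terms of the energy
inequality between times `s ≤ t ≤ s + 4`, on a ball of volume `V` where `(u - k)_+ ≤ m`. -/
noncomputable def energyRemainder (γ₂ γ₃ p m r R V : ℝ) : ℝ :=
  4 * (γ₂ / (R - r) ^ 2 * (m ^ 2 * V)) + γ₃ * (m ^ p * V) ^ (1 / p)

theorem energyRemainder_nonneg {V : ℝ} (hγ₂ : 0 ≤ γ₂) (hγ₃ : 0 ≤ γ₃) (hm : 0 ≤ m) (hV : 0 ≤ V) :
    0 ≤ energyRemainder γ₂ γ₃ p m r R V := by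
  unfold energyRemainder
  positivity

theorem EnergyInequality.le_add_energyRemainder {x₀ : Space d} {s t : ℝ}
    (h : EnergyInequality γ₁ γ₂ γ₃ p u k G x₀ r R s t) (hγ₂ : 0 ≤ γ₂) (hγ₃ : 0 ≤ γ₃) (hp : 1 ≤ p)
    (hm : 0 ≤ m) (hst : s ≤ t) (hts : t - s ≤ 4)
    (hu : ∀ᵐ τ ∂volume.restrict (Ioo s t), ∀ᵐ x ∂volume.restrict (Metric.ball x₀ R),
      truncPos u k (τ, x) ≤ m) :
    (∫⁻ x in Metric.ball x₀ r, ENNReal.ofReal (truncPos u k (t, x) ^ 2)) +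
        ENNReal.ofReal γ₁ * (∫⁻ τ in Ioo s t, ∫⁻ x in Metric.ball x₀ r, ‖G (τ, x)‖ₑ ^ 2) ≤
      (∫⁻ x in Metric.ball x₀ R, ENNReal.ofReal (truncPos u k (s, x) ^ 2)) +
        ENNReal.ofReal (energyRemainder γ₂ γ₃ p m r R (volume.real (Metric.ball x₀ R)) *
          (t - s) ^ (1 / p)) := by
  set V := volume.real (Metric.ball x₀ R)
  have : 0 ≤ V := measureReal_nonneg
  have hts₀ : 0 ≤ t - s := sub_nonneg.2 hst
  have hbound {q : ℝ} (hq : 0 ≤ q) : ∫⁻ τ in Ioo s t, ∫⁻ x in Metric.ball x₀ R,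
      ENNReal.ofReal (truncPos u k (τ, x) ^ q) ≤ ENNReal.ofReal (m ^ q * V * (t - s)) := by
    rw [ENNReal.ofReal_mul (by positivity), ENNReal.ofReal_mul (by positivity),
      ofReal_measureReal measure_ball_lt_top.ne, ← Real.volume_Ioo,
      ← Measure.restrict_apply_univ (Metric.ball x₀ R), ← Measure.restrict_apply_univ (Ioo s t)]
    refine lintegral_lintegral_le_of_ae_le ?_
    filter_upwards [hu] with τ hτ
    filter_upwards [hτ] with x hx
    exact ENNReal.ofReal_le_ofReal (Real.rpow_le_rpow (le_max_right _ _) hx hq)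
  have hsq := hbound zero_le_two
  simp only [Real.rpow_two] at hsq
  refine h.trans ?_
  rw [add_assoc, energyRemainder, add_mul, ENNReal.ofReal_add (by positivity) (by positivity)]
  refine add_le_add_right (add_le_add ?_ ?_) _
  · refine (mul_le_mul_right hsq _).trans ?_
    rw [← ENNReal.ofReal_mul (by positivity)]
    refine ENNReal.ofReal_le_ofReal ?_
    calc γ₂ / (R - r) ^ 2 * (m ^ 2 * V * (t - s))
        = γ₂ / (R - r) ^ 2 * (m ^ 2 * V) * (t - s) := by ring
      _ ≤ γ₂ / (R - r) ^ 2 * (m ^ 2 * V) * (4 * (t - s) ^ (1 / p)) := by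
          gcongr
          exact le_mul_rpow_one_div hp (by norm_num) hts₀ hts
      _ = 4 * (γ₂ / (R - r) ^ 2 * (m ^ 2 * V)) * (t - s) ^ (1 / p) := by ring
  · rw [mul_assoc γ₃, ENNReal.ofReal_mul hγ₃, ← Real.mul_rpow (by positivity) hts₀,
      ← ENNReal.ofReal_rpow_of_nonneg (by positivity) (by positivity)]
    gcongr
    exact hbound (by positivity)

theorem HasWeakSpatialGradient.mono_congr {Q Q' : Set (ℝ × Space d)} {f f' : ℝ × Space d → ℝ}
    (h : HasWeakSpatialGradient Q f G) (hQ : MeasurableSet Q) (hsub : Q' ⊆ Q)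
    (hff' : f =ᵐ[volume.restrict Q'] f') :
    HasWeakSpatialGradient Q' f' G := by
  refine ⟨(h.1.mono_set hsub).congr hff', h.2.1.mono_set hsub, fun φ hφ hφc hφQ' e => ?_⟩
  have hleft : ∫ z in Q', f' z * fderiv ℝ φ z (0, e) = ∫ z in Q, f z * fderiv ℝ φ z (0, e) := by
    rw [setIntegral_eq_of_subset_of_forall_sdiff_eq_zero hQ hsub fun z hz => by
      simp [fderiv_of_notMem_tsupport (𝕜 := ℝ) fun hz' => hz.2 (hφQ' hz')]]
    refine integral_congr_ae ?_
    filter_upwards [hff'] with z hz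
    rw [hz]
  have hright : ∫ z in Q', φ z * inner ℝ (G z) e = ∫ z in Q, φ z * inner ℝ (G z) e :=
    (setIntegral_eq_of_subset_of_forall_sdiff_eq_zero hQ hsub fun z hz => by
      simp [image_eq_zero_of_notMem_tsupport fun hz' => hz.2 (hφQ' hz')]).symm
  rw [hleft, hright, h.2.2 φ hφ hφc (hφQ'.trans hsub) e]

theorem setLIntegral_Ioo_le_of_ae_ae {a b c : ℝ} {F : ℝ → ℝ≥0∞} {M : ℝ≥0∞} (hac : a < c)
    (hcb : c < b) (h : ∀ᵐ s ∂volume.restrict (Ioo a b), ∀ᵐ t ∂volume.restrict (Ioo a b),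
      s < t → ∫⁻ τ in Ioo s t, F τ ≤ M) :
    ∫⁻ τ in Ioo c b, F τ ≤ M := by
  obtain ⟨s, hs, -, hst⟩ := exists_mem_Ioo_notMem_of_ae (N := ∅) le_rfl hcb.le (by simpa) h
  refine setLIntegral_Ioo_le_of_forall_lt fun b' hb' => ?_
  obtain ⟨t, ht, -, hle⟩ := exists_mem_Ioo_notMem_of_ae (N := ∅) (c := max b' c)
    (hac.le.trans (le_max_right _ _)) le_rfl (by simpa using ⟨hb', hcb⟩) hst
  rw [mem_Ioo, max_lt_iff] at ht
  exact ⟨t, ht.1.1.le,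
    (lintegral_mono_set (Ioo_subset_Ioo_left hs.2.le)).trans (hle (hs.2.trans ht.1.2))⟩

theorem ae_ae_lintegral_sq_add_le_of_energyInequality {a b : ℝ} {x₀ : Space d}
    {w : ℝ × Space d → ℝ}
    (h : ∀ᵐ s ∂volume.restrict (Ioo a b), ∀ᵐ t ∂volume.restrict (Ioo a b),
      s < t → EnergyInequality γ₁ γ₂ γ₃ p u k G x₀ r R s t)
    (hγ₂ : 0 ≤ γ₂) (hγ₃ : 0 ≤ γ₃) (hp : 1 ≤ p) (hrR : r ≤ R) (hab : b - a ≤ 4)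
    (huw : truncPos u k =ᵐ[volume.restrict (Ioo a b ×ˢ Metric.ball x₀ R)] w)
    (hm : 0 ≤ m) (hw : ∀ z, w z ≤ m) :
    ∀ᵐ s ∂volume.restrict (Ioo a b), ∀ᵐ t ∂volume.restrict (Ioo a b), s < t →
      (∫⁻ x in Metric.ball x₀ r, ENNReal.ofReal (w (t, x) ^ 2)) +
          ENNReal.ofReal γ₁ * (∫⁻ τ in Ioo s t, ∫⁻ x in Metric.ball x₀ r, ‖G (τ, x)‖ₑ ^ 2) ≤
        (∫⁻ x in Metric.ball x₀ R, ENNReal.ofReal (w (s, x) ^ 2)) +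
          ENNReal.ofReal (energyRemainder γ₂ γ₃ p m r R (volume.real (Metric.ball x₀ R)) *
            (t - s) ^ (1 / p)) := by
  have hslice := ae_ae_of_ae_restrict_prod huw
  filter_upwards [h, hslice, ae_restrict_mem measurableSet_Ioo] with s hs hws hsI
  filter_upwards [hs, hslice, ae_restrict_mem measurableSet_Ioo] with t hst hwt htI hlt
  have hbound : ∀ᵐ τ ∂volume.restrict (Ioo s t), ∀ᵐ x ∂volume.restrict (Metric.ball x₀ R),
      truncPos u k (τ, x) ≤ m := by
    filter_upwards [ae_restrict_of_ae_restrict_of_subset (Ioo_subset_Ioo hsI.1.le htI.2.le) hslice]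
      with τ hτ
    filter_upwards [hτ] with x hx
    exact hx.trans_le (hw _)
  have henergy := (hst hlt).le_add_energyRemainder hγ₂ hγ₃ hp hm hlt.le
    (by linarith [hsI.1, htI.2]) hbound
  have hcongr {σ ρ : ℝ} (hρ : ρ ≤ R)
      (hσ : ∀ᵐ x ∂volume.restrict (Metric.ball x₀ R), truncPos u k (σ, x) = w (σ, x)) :
      ∫⁻ x in Metric.ball x₀ ρ, ENNReal.ofReal (truncPos u k (σ, x) ^ 2) =
        ∫⁻ x in Metric.ball x₀ ρ, ENNReal.ofReal (w (σ, x) ^ 2) := by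
    refine lintegral_congr_ae ?_
    filter_upwards [ae_restrict_of_ae_restrict_of_subset (Metric.ball_subset_ball hρ) hσ] with x hx
    rw [hx]
  rwa [hcongr hrR hwt, hcongr le_rfl hws] at henergy

theorem setLIntegral_enorm_sq_le_of_energyInequality {a b c K : ℝ} {x₀ : Space d}
    {w : ℝ × Space d → ℝ} (hγ₁ : 0 < γ₁) (hp : 0 ≤ p) (hK : 0 ≤ K) (hac : a < c) (hcb : c < b)
    (hw₀ : ∀ z, 0 ≤ w z) (hw : ∀ z, w z ≤ m)
    (h : ∀ᵐ s ∂volume.restrict (Ioo a b), ∀ᵐ t ∂volume.restrict (Ioo a b), s < t →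
      (∫⁻ x in Metric.ball x₀ r, ENNReal.ofReal (w (t, x) ^ 2)) +
          ENNReal.ofReal γ₁ * (∫⁻ τ in Ioo s t, ∫⁻ x in Metric.ball x₀ r, ‖G (τ, x)‖ₑ ^ 2) ≤
        (∫⁻ x in Metric.ball x₀ R, ENNReal.ofReal (w (s, x) ^ 2)) +
          ENNReal.ofReal (K * (t - s) ^ (1 / p))) :
    ∫⁻ τ in Ioo c b, ∫⁻ x in Metric.ball x₀ r, ‖G (τ, x)‖ₑ ^ 2 ≤
      ENNReal.ofReal
        ((m ^ 2 * volume.real (Metric.ball x₀ R) + K * (b - a) ^ (1 / p)) / γ₁) := by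
  have hba : 0 ≤ b - a := sub_nonneg.2 (hac.trans hcb).le
  refine setLIntegral_Ioo_le_of_ae_ae hac hcb ?_
  filter_upwards [h, ae_restrict_mem measurableSet_Ioo] with s hs hsI
  filter_upwards [hs, ae_restrict_mem measurableSet_Ioo] with t hst htI hlt
  have : 0 ≤ t - s := sub_nonneg.2 hlt.le
  have hinitial : ∫⁻ x in Metric.ball x₀ R, ENNReal.ofReal (w (s, x) ^ 2) ≤
      ENNReal.ofReal (m ^ 2 * volume.real (Metric.ball x₀ R)) := by
    rw [ENNReal.ofReal_mul (by positivity), ofReal_measureReal measure_ball_lt_top.ne,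
      ← setLIntegral_const]
    exact lintegral_mono fun x => ENNReal.ofReal_le_ofReal (pow_le_pow_left₀ (hw₀ _) (hw _) 2)
  rw [ENNReal.ofReal_div_of_pos hγ₁, ENNReal.le_div_iff_mul_le (by simp [hγ₁]) (by simp), mul_comm,
    ENNReal.ofReal_add (by positivity) (by positivity)]
  refine (le_add_self.trans (hst hlt)).trans (add_le_add hinitial (ENNReal.ofReal_le_ofReal ?_))
  gcongr
  · exact htI.2.le
  · exact hsI.1.le

/-- The information about a truncation `w = (u - k)_+` of a member `u` of the De Giorgi class with
`0 ≤ w ≤ m` that enters the intermediate value lemma: `G` is its weak spatial gradient, with energy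
at most `K`, and the `L²` norm of `w` on a ball grows at most like `(t - s) ^ (1 / p)`, up to an
increase of the radius from `r` to `1`. -/
structure HasEnergyControl (p m r K : ℝ) (w : ℝ × Space d → ℝ) (G : ℝ × Space d → Space d) :
    Prop where
  measurable : Measurable w
  nonneg : ∀ z, 0 ≤ w z
  le : ∀ z, w z ≤ m
  hasWeakSpatialGradient : HasWeakSpatialGradient (cylinder d (3 / 2)) w G
  lintegral_gradient_le :
    ∫⁻ t in Ioo (-2) 0, ∫⁻ x in Metric.ball 0 1, ‖G (t, x)‖ₑ ^ 2 ≤ ENNReal.ofReal K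
  propagation : ∀ᵐ s ∂volume.restrict (Ioo (-2) 0), ∀ᵐ t ∂volume.restrict (Ioo (-2) 0), s < t →
    ∫⁻ x in Metric.ball 0 r, ENNReal.ofReal (w (t, x) ^ 2) ≤
      (∫⁻ x in Metric.ball 0 1, ENNReal.ofReal (w (s, x) ^ 2)) +
        ENNReal.ofReal (K * (t - s) ^ (1 / p))

theorem DGPlus.exists_bounded_measurable_ae_eq_truncPos {Ω : Set (Space d)} {T₁ T₂ : ℝ}
    {Q : Set (ℝ × Space d)} (hu : DGPlus Ω T₁ T₂ γ₁ γ₂ γ₃ p u) (hQ : Q ⊆ Ioo T₁ T₂ ×ˢ Ω)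
    (hm : 0 ≤ m) (hle : ∀ᵐ z ∂volume.restrict Q, u z ≤ k + m) :
    ∃ w, Measurable w ∧ (∀ z, 0 ≤ w z) ∧ (∀ z, w z ≤ m) ∧
      truncPos u k =ᵐ[volume.restrict Q] w := by
  obtain ⟨v, hv, huv⟩ := hu.memLinftyL2.1.aemeasurable
  refine ⟨fun z => min (truncPos v k z) m, ((hv.sub_const k).max measurable_const).min
    measurable_const, fun z => le_min (le_max_right _ _) hm, fun z => min_le_right _ _, ?_⟩
  filter_upwards [hle, ae_restrict_of_ae_restrict_of_subset hQ huv] with z hz huvz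
  simp only [truncPos, ← huvz]
  exact (min_eq_left (max_le (by linarith) hm)).symm

theorem DGPlus.exists_hasEnergyControl (hγ₁ : 0 < γ₁) (hγ₂ : 0 ≤ γ₂) (hγ₃ : 0 ≤ γ₃) (hp : 1 ≤ p)
    (hk : k ≤ 1) (hr : 0 < r) (hr₁ : r < 1) :
    ∃ K, 0 ≤ K ∧ ∀ u : ℝ × Space d → ℝ, DGPlus (Metric.ball 0 2) (-4) 0 γ₁ γ₂ γ₃ p u →
      (∀ᵐ z ∂volume.restrict (cylinder d (3 / 2)), u z ≤ 1) →
      ∃ w G, truncPos u k =ᵐ[volume.restrict (cylinder d (3 / 2))] w ∧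
        HasEnergyControl p (1 - k) r K w G := by
  have hm : 0 ≤ 1 - k := sub_nonneg.2 hk
  set a : ℝ := -(3 / 2) ^ 2 with ha
  let V : ℝ → ℝ := fun R => volume.real (Metric.ball (0 : Space d) R)
  let E : ℝ → ℝ → ℝ := fun r R => energyRemainder γ₂ γ₃ p (1 - k) r R (V R)
  have hE (r R : ℝ) : 0 ≤ E r R := energyRemainder_nonneg hγ₂ hγ₃ hm measureReal_nonneg
  let K := ((1 - k) ^ 2 * V (3 / 2) + E 1 (3 / 2) * (0 - a) ^ (1 / p)) / γ₁
  refine ⟨max (E r 1) K, (hE r 1).trans (le_max_left _ _), fun u hu hu₁ => ?_⟩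
  have hsub : cylinder d (3 / 2) ⊆ Ioo (-4) 0 ×ˢ Metric.ball 0 2 :=
    prod_mono (Ioo_subset_Ioo_left (by norm_num)) (Metric.ball_subset_ball (by norm_num))
  obtain ⟨w, hwm, hw₀, hw, huw⟩ :=
    hu.exists_bounded_measurable_ae_eq_truncPos (k := k) hsub hm (by simpa using hu₁)
  obtain ⟨G, hG, henergy⟩ := hu.energy k
  have henergy' {ρ R : ℝ} (hρ : 0 < ρ) (hρR : ρ < R) (hR : R ≤ 3 / 2) :
      ∀ᵐ s ∂volume.restrict (Ioo a 0), ∀ᵐ t ∂volume.restrict (Ioo a 0), s < t →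
        EnergyInequality γ₁ γ₂ γ₃ p u k G 0 ρ R s t := by
    have hI : Ioo a 0 ⊆ Ioo (-4) 0 := Ioo_subset_Ioo_left (by norm_num [ha])
    filter_upwards [ae_restrict_of_ae_restrict_of_subset hI (henergy ρ R hρ hρR 0 (by simp)
      (Metric.ball_subset_ball (by linarith)))] with s hs
    exact ae_restrict_of_ae_restrict_of_subset hI hs
  have hbound {ρ R : ℝ} (hρ : 0 < ρ) (hρR : ρ < R) (hR : R ≤ 3 / 2) :=
    ae_ae_lintegral_sq_add_le_of_energyInequality (henergy' hρ hρR hR) hγ₂ hγ₃ hp hρR.le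
      (by norm_num [ha]) (ae_restrict_of_ae_restrict_of_subset
        (prod_mono_right (Metric.ball_subset_ball hR)) huw) hm hw
  refine ⟨w, G, huw, hwm, hw₀, hw,
    hG.mono_congr (measurableSet_Ioo.prod measurableSet_ball) hsub huw, ?_, ?_⟩
  · exact (setLIntegral_enorm_sq_le_of_energyInequality hγ₁ (zero_le_one.trans hp) (hE 1 (3 / 2))
      (by norm_num [ha]) (by norm_num) hw₀ hw (hbound one_pos (by norm_num) le_rfl)).trans
      (ENNReal.ofReal_le_ofReal (le_max_right _ _))
  · have hI : Ioo (-2) 0 ⊆ Ioo a 0 := Ioo_subset_Ioo_left (by norm_num [ha])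
    filter_upwards [ae_restrict_of_ae_restrict_of_subset hI (hbound hr hr₁ (by norm_num))] with s hs
    filter_upwards [ae_restrict_of_ae_restrict_of_subset hI hs] with t hst hlt
    have : 0 ≤ t - s := sub_nonneg.2 hlt.le
    refine (le_self_add.trans (hst hlt)).trans
      (add_le_add_right (ENNReal.ofReal_le_ofReal ?_) _)
    gcongr
    exact le_max_left _ _

end Energy

section LevelSets

theorem exists_measureReal_ball_sub_le {E : Type*} [NormedAddCommGroup E] [NormedSpace ℝ E]
    [FiniteDimensional ℝ E] [MeasurableSpace E] [BorelSpace E] (μ : Measure E) [μ.IsAddHaarMeasure]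
    {δ : ℝ} (hδ : 0 < δ) :
    ∃ r, 0 < r ∧ r < 1 ∧
      μ.real (Metric.ball 0 1) - μ.real (Metric.ball 0 r) ≤ δ * μ.real (Metric.ball 0 1) := by
  have hcont : ∀ᶠ r in nhdsWithin (1 : ℝ) (Iio 1), 1 - δ < r ^ Module.finrank ℝ E :=
    (continuous_pow (Module.finrank ℝ E)).continuousWithinAt.eventually_const_lt (by simpa)
  obtain ⟨r, hr, hr₀, hr₁⟩ := (hcont.and (Ioo_mem_nhdsLT zero_lt_one)).exists
  refine ⟨r, hr₀, hr₁, ?_⟩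
  have hball : μ.real (Metric.ball 0 r) = r ^ Module.finrank ℝ E * μ.real (Metric.ball 0 1) := by
    rw [measureReal_def, Measure.addHaar_ball_of_pos μ 0 hr₀, ENNReal.toReal_mul,
      ENNReal.toReal_ofReal (by positivity), measureReal_def]
  rw [hball]
  nlinarith [measureReal_nonneg (μ := μ) (s := Metric.ball (0 : E) 1)]

variable {α : Type*} [MeasurableSpace α] {μ : Measure α} {f : α → ℝ} {lam m δ : ℝ}

theorem measureReal_ge_add_measureReal_between [IsFiniteMeasure μ] (hf : Measurable f)
    (hlam : 0 < lam) :
    μ.real {x | lam ≤ f x} + μ.real {x | 0 < f x ∧ f x < lam} = μ.real {x | 0 < f x} := by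
  have hdisj : Disjoint {x | lam ≤ f x} {x | 0 < f x ∧ f x < lam} :=
    Set.disjoint_left.2 fun x hx hx' => hx'.2.not_ge hx
  rw [← measureReal_union hdisj
    ((measurableSet_lt measurable_const hf).inter (measurableSet_lt hf measurable_const))]
  congr 1
  ext x
  simp only [mem_union, mem_ofPred_eq]
  grind

theorem measureReal_le_add_ge_add_between [IsFiniteMeasure μ] (hf : Measurable f)
    (hlam : 0 < lam) :
    μ.real {x | f x ≤ 0} + μ.real {x | lam ≤ f x} + μ.real {x | 0 < f x ∧ f x < lam} =
      μ.real univ := by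
  rw [add_assoc, measureReal_ge_add_measureReal_between hf hlam,
    ← measureReal_add_measureReal_compl (measurableSet_le hf measurable_const)]
  congr 2
  ext x
  simp

theorem ofReal_sq_mul_sub_le_setLIntegral_sq {s t : Set α} (hf : Measurable f) (hlam : 0 ≤ lam)
    (hs : MeasurableSet s) (hst : s ⊆ t) (ht : μ t ≠ ∞) (hδ : μ.real t - μ.real s ≤ δ) :
    ENNReal.ofReal (lam ^ 2 * ((μ.restrict t).real {x | lam ≤ f x} - δ)) ≤
      ∫⁻ x in s, ENNReal.ofReal (f x ^ 2) ∂μ := by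
  have hS : MeasurableSet {x | lam ≤ f x} := measurableSet_le measurable_const hf
  have hrestrict :
      (μ.restrict t).real {x | lam ≤ f x} - δ ≤ (μ.restrict s).real {x | lam ≤ f x} := by
    have hunion : {x | lam ≤ f x} ∩ t ⊆ ({x | lam ≤ f x} ∩ s) ∪ t \ s := fun x hx => by
      by_cases hxs : x ∈ s
      exacts [Or.inl ⟨hx.1, hxs⟩, Or.inr ⟨hx.2, hxs⟩]
    rw [measureReal_restrict_apply hS, measureReal_restrict_apply hS]
    have hle := (measureReal_mono hunion (measure_ne_top_of_subset
      (union_subset (inter_subset_right.trans hst) sdiff_subset) ht)).trans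
        (measureReal_union_le _ _)
    rw [measureReal_sdiff hst hs ht] at hle
    linarith
  calc ENNReal.ofReal (lam ^ 2 * ((μ.restrict t).real {x | lam ≤ f x} - δ))
      ≤ ENNReal.ofReal (lam ^ 2 * (μ.restrict s).real {x | lam ≤ f x}) := by gcongr
    _ ≤ ENNReal.ofReal (lam ^ 2) * μ.restrict s {x | lam ≤ f x} := by
        rw [ENNReal.ofReal_mul (sq_nonneg lam)]
        gcongr
        exact ENNReal.ofReal_toReal_le
    _ ≤ ENNReal.ofReal (lam ^ 2) *
          μ.restrict s {x | ENNReal.ofReal (lam ^ 2) ≤ ENNReal.ofReal (f x ^ 2)} := by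
        gcongr with x
        exact fun hx => ENNReal.ofReal_le_ofReal (pow_le_pow_left₀ hlam hx 2)
    _ ≤ ∫⁻ x in s, ENNReal.ofReal (f x ^ 2) ∂μ :=
        mul_meas_ge_le_lintegral (hf.pow_const 2).ennreal_ofReal _

theorem lintegral_sq_le_ofReal_sq_mul [IsFiniteMeasure μ] (hf : Measurable f) (hf₀ : ∀ x, 0 ≤ f x)
    (hfm : ∀ x, f x ≤ m) :
    ∫⁻ x, ENNReal.ofReal (f x ^ 2) ∂μ ≤ ENNReal.ofReal (m ^ 2 * μ.real {x | 0 < f x}) := by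
  rw [ENNReal.ofReal_mul (sq_nonneg m), ofReal_measureReal,
    ← lintegral_indicator_const (measurableSet_lt measurable_const hf)]
  refine lintegral_mono fun x => ?_
  rcases (hf₀ x).eq_or_lt with hx | hx
  · simp [← hx]
  · rw [indicator_of_mem (show x ∈ {x | 0 < f x} from hx)]
    exact ENNReal.ofReal_le_ofReal (pow_le_pow_left₀ hx.le (hfm x) 2)

theorem measureReal_preimage_inter_eq_of_ae_eq {g : α → ℝ} {s : Set α} (hs : MeasurableSet s)
    (h : f =ᵐ[μ.restrict s] g) (T : Set ℝ) :
    μ.real (f ⁻¹' T ∩ s) = (μ.restrict s).real (g ⁻¹' T) := by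
  rw [← measureReal_restrict_apply' hs]
  exact measureReal_congr (h.preimage T)

variable {d : ℕ} {p r K k l : ℝ} {B : Set (Space d)} {S : Set (ℝ × Space d)}
  {u w : ℝ × Space d → ℝ} {G : ℝ × Space d → Space d}

instance isFiniteMeasure_restrict_ball (x : Space d) (ρ : ℝ) :
    IsFiniteMeasure (volume.restrict (Metric.ball x ρ)) :=
  isFiniteMeasure_restrict.2 measure_ball_lt_top.ne

/-- The volume of the part in `B` of the slice of `S` at time `t`; the quantities `A(t)`, `B(t)` and
`D(t)` of the argument are slice volumes of level sets. -/
noncomputable def sliceVolume (B : Set (Space d)) (S : Set (ℝ × Space d)) (t : ℝ) : ℝ :=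
  (volume.restrict B).real (Prod.mk t ⁻¹' S)

theorem measurable_sliceVolume (hS : MeasurableSet S) : Measurable (sliceVolume B S) :=
  (measurable_measure_prodMk_left hS).ennreal_toReal

theorem setIntegral_sliceVolume (hB : volume B ≠ ∞) (hS : MeasurableSet S) (I : Set ℝ) :
    ∫ t in I, sliceVolume B S t = (volume.restrict (I ×ˢ B)).real S := by
  have : IsFiniteMeasure (volume.restrict B) := isFiniteMeasure_restrict.2 hB
  rw [measureReal_def, Measure.volume_eq_prod, ← Measure.prod_restrict, Measure.prod_apply hS]
  exact integral_toReal (measurable_measure_prodMk_left hS).aemeasurable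
    (.of_forall fun t => measure_lt_top _ _)

theorem HasEnergyControl.setLIntegral_prod_le (h : HasEnergyControl p m r K w G) :
    ∫⁻ z in Ioo (-2) 0 ×ˢ Metric.ball 0 1, ‖G z‖ₑ ^ 2 ≤ ENNReal.ofReal K := by
  have hsub : Ioo (-2) 0 ×ˢ Metric.ball (0 : Space d) 1 ⊆ cylinder d (3 / 2) :=
    prod_mono (Ioo_subset_Ioo_left (by norm_num)) (Metric.ball_subset_ball (by norm_num))
  rw [setLIntegral_prod]
  · exact h.lintegral_gradient_le
  · exact (h.hasWeakSpatialGradient.2.1.aestronglyMeasurable.mono_set hsub).enorm.pow_const 2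

theorem exists_setLIntegral_measure_mul_measure_le (d : ℕ) (hK : 0 ≤ K) :
    ∃ M, 0 ≤ M ∧ ∀ {p m r lam : ℝ} {w : ℝ × Space d → ℝ} {G : ℝ × Space d → Space d},
      HasEnergyControl p m r K w G → 0 < lam →
      ∫⁻ t in Ioo (-2) 0, volume.restrict (Metric.ball 0 1) {x | w (t, x) ≤ 0} *
          volume.restrict (Metric.ball 0 1) {x | lam ≤ w (t, x)} ≤
        ENNReal.ofReal (M * (volume.restrict (Ioo (-2) 0 ×ˢ Metric.ball 0 1)).real
          {z | 0 < w z ∧ w z < lam} ^ (1 / 2 : ℝ) / lam) := by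
  obtain ⟨M, hM, hiso⟩ := exists_lintegral_measure_mul_measure_le
  set B := Metric.ball (0 : Space d) 1
  refine ⟨Metric.diam B * (2 ^ d * volume.real B) * M * K ^ (1 / 2 : ℝ), by positivity,
    fun {p m r lam w G} h hlam => setLIntegral_Ioo_le_of_forall_lt fun b hb => ⟨b, le_rfl, ?_⟩⟩
  set P := Ioo (-2 : ℝ) 0 ×ˢ B
  set mid := {z | 0 < w z ∧ w z < lam}
  have hsub : Ioo (-2) b ×ˢ B ⊆ P := prod_mono_left (Ioo_subset_Ioo_right hb.le)
  have hP : IsFiniteMeasure (volume.restrict P) := isFiniteMeasure_restrict.2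
    ((Metric.isBounded_Ioo _ _).prod Metric.isBounded_ball).measure_lt_top.ne
  calc _ ≤ Metric.ediam B * (2 ^ d * volume B) * (ENNReal.ofReal (M / lam) *
        ((∫⁻ z in Ioo (-2) b ×ˢ B, ‖G z‖ₑ ^ 2) *
          volume.restrict (Ioo (-2) b ×ˢ B) mid) ^ (1 / 2 : ℝ)) :=
        hiso (K := Icc (-2) b ×ˢ Metric.closedBall 0 1) h.hasWeakSpatialGradient
          (isOpen_Ioo.prod Metric.isOpen_ball) (isCompact_Icc.prod (isCompact_closedBall _ _))
          (prod_mono (fun t ht => ⟨by linarith [ht.1], ht.2.trans_lt hb⟩)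
            (Metric.closedBall_subset_ball (by norm_num)))
          (prod_mono Ioo_subset_Icc_self Metric.ball_subset_closedBall) measurableSet_Ioo
          measurableSet_ball (convex_ball _ _) Metric.isBounded_ball h.measurable hlam
    _ ≤ Metric.ediam B * (2 ^ d * volume B) * (ENNReal.ofReal (M / lam) *
        (ENNReal.ofReal K * volume.restrict P mid) ^ (1 / 2 : ℝ)) := by
        gcongr
        exact (lintegral_mono_set hsub).trans h.setLIntegral_prod_le
    _ = _ := by
        rw [← ofReal_measureReal (s := mid), ← ofReal_measureReal (s := B) measure_ball_lt_top.ne,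
          ← ENNReal.ofReal_toReal Metric.isBounded_ball.ediam_ne_top, ← Metric.diam,
          ← ENNReal.ofReal_mul hK, ENNReal.ofReal_rpow_of_nonneg (by positivity) (by positivity),
          show (2 : ℝ≥0∞) ^ d = ENNReal.ofReal (2 ^ d) by simp [ENNReal.ofReal_pow],
          ← ENNReal.ofReal_mul (by positivity), ← ENNReal.ofReal_mul (by positivity),
          ← ENNReal.ofReal_mul (by positivity), ← ENNReal.ofReal_mul (by positivity),
          Real.mul_rpow hK (by positivity)]
        congr 1
        ring

theorem exists_integral_sliceVolume_mul_sliceVolume_le (d : ℕ) (hK : 0 ≤ K) :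
    ∃ M, 0 ≤ M ∧ ∀ {p m r lam : ℝ} {w : ℝ × Space d → ℝ} {G : ℝ × Space d → Space d},
      HasEnergyControl p m r K w G → 0 < lam →
      ∫ t in Ioo (-2) 0, sliceVolume (Metric.ball 0 1) {z | w z ≤ 0} t *
          sliceVolume (Metric.ball 0 1) {z | lam ≤ w z} t ≤
        M * (volume.restrict (Ioo (-2) 0 ×ˢ Metric.ball 0 1)).real
          {z | 0 < w z ∧ w z < lam} ^ (1 / 2 : ℝ) / lam := by
  obtain ⟨M, hM, hiso⟩ := exists_setLIntegral_measure_mul_measure_le d hK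
  refine ⟨M, hM, fun {p m r lam w G} h hlam => ?_⟩
  have hmeas : Measurable fun t => volume.restrict (Metric.ball 0 1) {x | w (t, x) ≤ 0} *
      volume.restrict (Metric.ball 0 1) {x | lam ≤ w (t, x)} :=
    (measurable_measure_prodMk_left (measurableSet_le h.measurable measurable_const)).mul
      (measurable_measure_prodMk_left (measurableSet_le measurable_const h.measurable))
  simp only [sliceVolume, measureReal_def, ← ENNReal.toReal_mul]
  have htoReal := integral_toReal (μ := volume.restrict (Ioo (-2) 0)) hmeas.aemeasurable
    (.of_forall fun t => ENNReal.mul_lt_top (measure_lt_top _ _) (measure_lt_top _ _))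
  refine htoReal.trans_le (ENNReal.toReal_le_of_le_ofReal (by positivity) (hiso h hlam))

theorem HasEnergyControl.sq_mul_sliceVolume_le (h : HasEnergyControl p m r K w G) (hlam : 0 < lam)
    (hK : 0 ≤ K) (hr : r ≤ 1)
    (hδ : volume.real (Metric.ball (0 : Space d) 1) -
      volume.real (Metric.ball (0 : Space d) r) ≤ δ) :
    ∀ᵐ s ∂volume.restrict (Ioo (-2) 0), ∀ᵐ t ∂volume.restrict (Ioo (-2) 0), s < t →
      lam ^ 2 * (sliceVolume (Metric.ball 0 1) {z | lam ≤ w z} t - δ) ≤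
        m ^ 2 * (sliceVolume (Metric.ball 0 1) {z | lam ≤ w z} s +
          sliceVolume (Metric.ball 0 1) {z | 0 < w z ∧ w z < lam} s) + K * (t - s) ^ (1 / p) := by
  have hslice (t : ℝ) : Measurable fun x => w (t, x) := h.measurable.comp measurable_prodMk_left
  filter_upwards [h.propagation] with s hs
  filter_upwards [hs] with t hst hlt
  have : 0 ≤ t - s := sub_nonneg.2 hlt.le
  have hchain := (ofReal_sq_mul_sub_le_setLIntegral_sq (hslice t) hlam.le measurableSet_ball
    (Metric.ball_subset_ball hr) measure_ball_lt_top.ne hδ).trans ((hst hlt).trans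
      (add_le_add_left (lintegral_sq_le_ofReal_sq_mul (hslice s) (fun x => h.nonneg _)
        fun x => h.le _) _))
  rw [← measureReal_ge_add_measureReal_between (hslice s) hlam,
    ← ENNReal.ofReal_add (by positivity) (by positivity),
    ENNReal.ofReal_le_ofReal_iff (by positivity)] at hchain
  exact hchain

theorem HasEnergyControl.exists_levelProfile (hm : 0 < m) (hp : 0 ≤ p) (hK : 0 ≤ K) (hr : r ≤ 1)
    (hball : volume.real (Metric.ball (0 : Space d) 1) -
      volume.real (Metric.ball (0 : Space d) r) ≤ volume.real (Metric.ball (0 : Space d) 1) / 8) :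
    ∃ K₀, 1 ≤ K₀ ∧ ∀ {lam : ℝ} {w : ℝ × Space d → ℝ} {G : ℝ × Space d → Space d},
      HasEnergyControl p m r K w G → 0 < lam →
      LevelProfile p (volume.real (Metric.ball (0 : Space d) 1)) K₀ (lam / m)
        ((volume.restrict (Ioo (-2) 0 ×ˢ Metric.ball 0 1)).real
          {z | 0 < w z ∧ w z < lam} ^ (1 / (4 * p + 2)))
        (sliceVolume (Metric.ball 0 1) {z | w z ≤ 0})
        (sliceVolume (Metric.ball 0 1) {z | lam ≤ w z})
        (sliceVolume (Metric.ball 0 1) {z | 0 < w z ∧ w z < lam}) := by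
  obtain ⟨M, hM, hiso⟩ := exists_integral_sliceVolume_mul_sliceVolume_le d hK
  set K₀ := 1 + K / m ^ 2 + M / m with hK₀
  have hKm : 0 ≤ K / m ^ 2 := by positivity
  have hMm : 0 ≤ M / m := by positivity
  refine ⟨K₀, by linarith [hK₀], fun {lam w G} h hlam => ?_⟩
  have hlow : MeasurableSet {z | w z ≤ 0} := measurableSet_le h.measurable measurable_const
  have hhigh : MeasurableSet {z | lam ≤ w z} := measurableSet_le measurable_const h.measurable
  have hmid : MeasurableSet {z | 0 < w z ∧ w z < lam} :=
    (measurableSet_lt measurable_const h.measurable).inter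
      (measurableSet_lt h.measurable measurable_const)
  refine ⟨measurable_sliceVolume hlow, measurable_sliceVolume hhigh, measurable_sliceVolume hmid,
    fun t => measureReal_nonneg, fun t => measureReal_nonneg, fun t => measureReal_nonneg,
    fun t => ?_, ?_, ?_, ?_⟩
  · rw [← measureReal_restrict_apply_univ]
    exact measureReal_le_add_ge_add_between (h.measurable.comp measurable_prodMk_left) hlam
  · rw [← Real.rpow_mul measureReal_nonneg,
      show 1 / (4 * p + 2) * (2 * p + 1) = 1 / 2 by field_simp; ring]
    refine (hiso h hlam).trans ?_
    set y := (volume.restrict (Ioo (-2) 0 ×ˢ Metric.ball 0 1)).real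
      {z | 0 < w z ∧ w z < lam} ^ (1 / 2 : ℝ)
    calc M * y / lam = M / m * y / (lam / m) := by field_simp
      _ ≤ K₀ * y / (lam / m) := by gcongr; linarith
  · rw [← Real.rpow_mul measureReal_nonneg, one_div_mul_cancel (by positivity), Real.rpow_one,
      setIntegral_sliceVolume measure_ball_lt_top.ne hmid]
  · filter_upwards [h.sq_mul_sliceVolume_le hlam hK hr hball] with s hs
    filter_upwards [hs] with t hst hlt
    have : 0 ≤ (t - s) ^ (1 / p) := Real.rpow_nonneg (sub_nonneg.2 hlt.le) _
    set β := sliceVolume (Metric.ball 0 1) {z | lam ≤ w z} s +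
      sliceVolume (Metric.ball 0 1) {z | 0 < w z ∧ w z < lam} s
    have hβ : 0 ≤ β := add_nonneg measureReal_nonneg measureReal_nonneg
    rw [div_pow, div_mul_eq_mul_div, div_le_iff₀ (by positivity)]
    calc _ ≤ m ^ 2 * β + K * (t - s) ^ (1 / p) := hst hlt
      _ = (1 * β + K / m ^ 2 * (t - s) ^ (1 / p)) * m ^ 2 := by field_simp
      _ ≤ (K₀ * β + K₀ * (t - s) ^ (1 / p)) * m ^ 2 := by gcongr <;> linarith
      _ = K₀ * (β + (t - s) ^ (1 / p)) * m ^ 2 := by ring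

theorem exists_sq_mul_measureReal_mul_measureReal_le (hp : 1 ≤ p) (hm : 0 < m) (hK : 0 ≤ K)
    (hr : r ≤ 1) (hball : volume.real (Metric.ball (0 : Space d) 1) -
      volume.real (Metric.ball (0 : Space d) r) ≤ volume.real (Metric.ball (0 : Space d) 1) / 8) :
    ∃ C, 0 < C ∧ ∀ {lam : ℝ} {w : ℝ × Space d → ℝ} {G : ℝ × Space d → Space d},
      HasEnergyControl p m r K w G → 0 < lam → lam ≤ m →
      lam ^ 2 * ((volume.restrict (earlierCylinder d)).real {z | w z ≤ 0} *
          (volume.restrict (cylinder d 1)).real {z | lam ≤ w z}) ≤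
        C * (volume.restrict (Ioo (-2) 0 ×ˢ Metric.ball 0 1)).real
          {z | 0 < w z ∧ w z < lam} ^ (1 / (4 * p + 2)) := by
  have hV : 0 < volume.real (Metric.ball (0 : Space d) 1) :=
    ENNReal.toReal_pos (Metric.measure_ball_pos _ _ one_pos).ne' measure_ball_lt_top.ne
  obtain ⟨K₀, hK₀, hlevel⟩ :=
    HasEnergyControl.exists_levelProfile hm (zero_le_one.trans hp) hK hr hball
  obtain ⟨C, hC, hprofile⟩ :=
    LevelProfile.exists_mul_integral_mul_integral_le (p := p) hp hV hK₀
  refine ⟨m ^ 2 * C, by positivity, fun {lam w G} h hlam hlamm => ?_⟩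
  have hest := hprofile _ _ _ _ _ (by positivity) ((div_le_one hm).2 hlamm) (by positivity)
    (hlevel h hlam)
  rw [mul_assoc (m ^ 2)]
  rwa [setIntegral_sliceVolume measure_ball_lt_top.ne
      (measurableSet_le h.measurable measurable_const),
    setIntegral_sliceVolume measure_ball_lt_top.ne
      (measurableSet_le measurable_const h.measurable),
    div_pow, div_mul_eq_mul_div, div_le_iff₀' (by positivity),
    show Ioo (-1 : ℝ) 0 = Ioo (-1 ^ 2) 0 by norm_num] at hest

theorem measureReal_le_inter_eq {E : Set (ℝ × Space d)} (hE : MeasurableSet E)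
    (huw : truncPos u k =ᵐ[volume.restrict E] w) :
    volume.real ({z | u z ≤ k} ∩ E) = (volume.restrict E).real {z | w z ≤ 0} := by
  have hset : {z | u z ≤ k} = truncPos u k ⁻¹' Iic 0 := by
    ext z
    simp [truncPos]
  rw [hset]
  exact measureReal_preimage_inter_eq_of_ae_eq hE huw _

theorem measureReal_ge_inter_eq {E : Set (ℝ × Space d)} (hE : MeasurableSet E) (hkl : k < l)
    (huw : truncPos u k =ᵐ[volume.restrict E] w) :
    volume.real ({z | l ≤ u z} ∩ E) = (volume.restrict E).real {z | l - k ≤ w z} := by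
  have hset : {z | l ≤ u z} = truncPos u k ⁻¹' Ici (l - k) := by
    ext z
    simp [truncPos, hkl]
  rw [hset]
  exact measureReal_preimage_inter_eq_of_ae_eq hE huw _

theorem measureReal_between_inter_eq {E : Set (ℝ × Space d)} (hE : MeasurableSet E)
    (huw : truncPos u k =ᵐ[volume.restrict E] w) :
    volume.real ({z | k < u z ∧ u z < l} ∩ E) =
      (volume.restrict E).real {z | 0 < w z ∧ w z < l - k} := by
  have hset : {z | k < u z ∧ u z < l} = truncPos u k ⁻¹' Ioo 0 (l - k) := by
    ext z
    simp only [truncPos, mem_preimage, mem_Ioo, lt_max_iff, max_lt_iff, mem_ofPred_eq]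
    grind
  rw [hset]
  exact measureReal_preimage_inter_eq_of_ae_eq hE huw _

theorem Ioo_prod_ball_subset_cylinder {a b ρ R : ℝ} (ha : -R ^ 2 ≤ a) (hb : b ≤ 0) (hρ : ρ ≤ R) :
    Ioo a b ×ˢ Metric.ball (0 : Space d) ρ ⊆ cylinder d R :=
  prod_mono (Ioo_subset_Ioo ha hb) (Metric.ball_subset_ball hρ)

theorem sq_mul_measureReal_mul_measureReal_le_of_ae_eq {C e : ℝ} (hC : 0 ≤ C) (he : 0 ≤ e)
    (hkl : k < l) (huw : truncPos u k =ᵐ[volume.restrict (cylinder d (3 / 2))] w)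
    (h : (l - k) ^ 2 * ((volume.restrict (earlierCylinder d)).real {z | w z ≤ 0} *
        (volume.restrict (cylinder d 1)).real {z | l - k ≤ w z}) ≤
      C * (volume.restrict (Ioo (-2) 0 ×ˢ Metric.ball 0 1)).real
        {z | 0 < w z ∧ w z < l - k} ^ e) :
    (l - k) ^ 2 * volume.real ({z | u z ≤ k} ∩ earlierCylinder d) *
        volume.real ({z | l ≤ u z} ∩ cylinder d 1) ≤
      C * volume.real ({z | k < u z ∧ u z < l} ∩ cylinder d 2) ^ e := by
  have hae {a b ρ : ℝ} (ha : -(3 / 2) ^ 2 ≤ a) (hb : b ≤ 0) (hρ : ρ ≤ 3 / 2) :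
      truncPos u k =ᵐ[volume.restrict (Ioo a b ×ˢ Metric.ball 0 ρ)] w :=
    ae_restrict_of_ae_restrict_of_subset (Ioo_prod_ball_subset_cylinder ha hb hρ) huw
  have hmeas {a b ρ : ℝ} : MeasurableSet (Ioo a b ×ˢ Metric.ball (0 : Space d) ρ) :=
    measurableSet_Ioo.prod measurableSet_ball
  rw [mul_assoc, earlierCylinder, cylinder,
    measureReal_le_inter_eq hmeas (hae (by norm_num) (by norm_num) (by norm_num)),
    measureReal_ge_inter_eq hmeas hkl (hae (by norm_num) (by norm_num) (by norm_num))]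
  refine h.trans ?_
  rw [← measureReal_between_inter_eq hmeas (hae (by norm_num) le_rfl (by norm_num))]
  gcongr
  · exact measure_ne_top_of_subset inter_subset_right
      ((Metric.isBounded_Ioo _ _).prod Metric.isBounded_ball).measure_lt_top.ne
  · exact Ioo_prod_ball_subset_cylinder (by norm_num) le_rfl (by norm_num)

end LevelSets

end ParabolicDG

theorem theorem1p5_general (d : ℕ) (γ₁ γ₂ γ₃ p k : ℝ)
    (hγ₁ : 0 < γ₁) (hγ₂ : 0 ≤ γ₂) (hγ₃ : 0 ≤ γ₃) (hp₁ : 1 ≤ p) :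
    ∃ C : ℝ, 0 < C ∧
      ∀ u : ℝ × ParabolicDG.Space d → ℝ,
        ParabolicDG.DGPlus (Metric.ball (0 : ParabolicDG.Space d) 2) (-4) 0 γ₁ γ₂ γ₃ p u →
        (∀ᵐ z ∂(volume.restrict (ParabolicDG.cylinder d (3 / 2))), u z ≤ 1) →
        ∀ l : ℝ, k < l → l ≤ 1 →
          (l - k) ^ 2
              * volume.real ({z | u z ≤ k} ∩ ParabolicDG.earlierCylinder d)
              * volume.real ({z | l ≤ u z} ∩ ParabolicDG.cylinder d 1)
            ≤ C * volume.real ({z | k < u z ∧ u z < l} ∩ ParabolicDG.cylinder d 2)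
                  ^ (1 / (4 * p + 2)) := by
  rcases le_or_gt 1 k with hk | hk
  · exact ⟨1, one_pos, fun u _ _ l hkl hl => absurd (hkl.trans_le hl) hk.not_gt⟩
  obtain ⟨r, hr₀, hr₁, hball⟩ :=
    ParabolicDG.exists_measureReal_ball_sub_le (volume : Measure (ParabolicDG.Space d))
      (one_div_pos.2 (by norm_num : (0 : ℝ) < 8))
  rw [one_div_mul_eq_div] at hball
  obtain ⟨K, hK, hcontrol⟩ :=
    ParabolicDG.DGPlus.exists_hasEnergyControl (d := d) hγ₁ hγ₂ hγ₃ hp₁ hk.le hr₀ hr₁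
  obtain ⟨C, hC, hest⟩ := ParabolicDG.exists_sq_mul_measureReal_mul_measureReal_le hp₁
    (sub_pos.2 hk) hK hr₁.le hball
  refine ⟨C, hC, fun u hu hu₁ l hkl hl => ?_⟩
  obtain ⟨w, G, huw, hw⟩ := hcontrol u hu hu₁
  exact ParabolicDG.sq_mul_measureReal_mul_measureReal_le_of_ae_eq hC.le (by positivity) hkl huw
    (hest hw (sub_pos.2 hkl) (by linarith))

theorem theorem1p5 (d : ℕ) (hd : 1 ≤ d) (γ₁ γ₂ γ₃ p k : ℝ)
    (hγ₁ : 0 < γ₁) (hγ₂ : 0 < γ₂) (hγ₃ : 0 < γ₃)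
    (hp₁ : 1 ≤ p) (hp₂ : p ≤ ((d : ℝ) + 2) / d) :
    ∃ C : ℝ, 0 < C ∧
      ∀ u : ℝ × ParabolicDG.Space d → ℝ,
        ParabolicDG.DGPlus (Metric.ball (0 : ParabolicDG.Space d) 2) (-4) 0 γ₁ γ₂ γ₃ p u →
        (∀ᵐ z ∂(volume.restrict (ParabolicDG.cylinder d (3 / 2))), u z ≤ 1) →
        ∀ l : ℝ, k < l → l ≤ 1 →
          (l - k) ^ 2
              * volume.real ({z | u z ≤ k} ∩ ParabolicDG.earlierCylinder d)
              * volume.real ({z | l ≤ u z} ∩ ParabolicDG.cylinder d 1)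
            ≤ C * volume.real ({z | k < u z ∧ u z < l} ∩ ParabolicDG.cylinder d 2)
                  ^ (1 / (4 * p + 2)) :=
  theorem1p5_general d γ₁ γ₂ γ₃ p k hγ₁ hγ₂.le hγ₃.le hp₁
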